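/- **Setting.** Let $d,m,J,N,K$ be natural numbers with $N,K\ge 1$, let $\mathcal I=\{(k,l)\in\{1,\dots,m\}^2:k<l\}$, $c_m=3^m2^{m(m-1)/2}$, $\tilde c_m=c_m-(3/2)^m$. Let $(\xi_j,V_j)$, $j=1,\dots,J$, be independent pairs such that $\xi_j$ and $V_j$ are independent, $\xi_j=(\xi_j^k)_{k\le m}$ has i.i.d. coordinates with $\mathbb P(\xi_j^k=\pm\sqrt3)=\frac16$, $\mathbb P(\xi_j^k=0)=\frac23$, and $V_j=(V_j^{kl})_{(k,l)\in\mathcal I}$ has i.i.d. coordinates with $\mathbb P(V_j^{kl}=\pm1)=\frac12$. For a measurable $\Phi_\Delta$ ($\Delta=T/J$) and a fixed $x_0\in\mathbb R^d$ put $X_{\Delta,0}=x_0$, $X_{\Delta,j\Delta}=\Phi_\Delta(X_{\Delta,(j-1)\Delta},\xi_j,V_j)$, and let $\mathbb P_{\Delta,j}$ be the law of $X_{\Delta,j\Delta}$. For a measurable $f:\mathbb R^d\to\mathbb R$ let $q_j(x)=\mathbb E[f(X_{\Delta,T})\mid X_{\Delta,j\Delta}=x]$, i.e. the expectation of $f$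 at the terminal point of the scheme started at step $j$ in $x$, and for $y\in\{-\sqrt3,0,\sqrt3\}^m$, $z\in\{-1,1\}^{\mathcal I}$ let $$h_{j,y,z}(x)=q_j(\Phi_\Delta(x,y,z))=\mathbb E[q_j(X_{\Delta,j\Delta})\mid X_{\Delta,(j-1)\Delta}=x,\ \xi_j=y,\ V_j=z],\qquad p_m(y)=\frac{4^{\#\{i:y_i=0\}}}{6^m2^{m(m-1)/2}} .$$ Let $\psi_1,\dots,\psi_K:\mathbb R^d\to\mathbb R$ be measurable, $\Psi_K=\operatorname{span}\{\psi_1,\dots,\psi_K\}$, and let $A,\kappa,C_\kappa>0$. **Assumptions** (for all $j\in\{1,\dots,J\}$ and all $y,z$): (A1) $\sup_{x\in\mathbb R^d}|h_{j,y,z}(x)|\le A$. (A2) $\inf_{g\in\Psi_K}\int(h_{j,y,z}-g)^2\,d\mathbb P_{\Delta,j-1}\le C_\kappa K^{-\kappa}$. (A3) Let $D_N^{tr}$ be $N$ independent training paths of the scheme, started in $x_0$, together with their innovations, independent of the testing path $(X_{\Delta,j\Delta})_j$. Let $\hat h_{j,y,z}=\hat h_{j,y,z}(\cdot,D_N^{tr})\in\Psi_K$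 be obtained by linear least squares regression of the responses $q_j(X_{\Delta,j\Delta}^{tr,(i)})$ on $\psi_1(X_{\Delta,(j-1)\Delta}^{tr,(i)}),\dots,\psi_K(X_{\Delta,(j-1)\Delta}^{tr,(i)})$ over those training paths $i$ with $\xi_j^{tr,(i)}=y$, $V_j^{tr,(i)}=z$ (any minimiser whose coefficients are measurable functions of $D_N^{tr}$), and let $\tilde h_{j,y,z}=T_A\hat h_{j,y,z}$, where $T_At=t$ if $|t|\le A$ and $T_At=A\operatorname{sgn}t$ otherwise. **Control variate.** With $H_0(t)=1$, $H_1(t)=t$, $H_2(t)=(t^2-1)/\sqrt2$ and $\mathcal U=(\{0,1,2\}^m\times\{0,1\}^{\mathcal I})\setminus\{(0,0)\}$ put, for $(o,r)\in\mathcal U$, $$\tilde a_{j,o,r}(x)=\sum_{y,z}p_m(y)\prod_{i=1}^mH_{o_i}(y_i)\prod_{(k,l)\in\mathcal I}z_{kl}^{r_{kl}}\ \tilde h_{j,y,z}(x),$$ $$\tilde M^{(2)}_{\Delta,T}=\sum_{j=1}^J\sum_{(o,r)\in\mathcal U}\tilde a_{j,o,r}(X_{\Delta,(j-1)\Delta},D_N^{tr})\prod_{i=1}^mH_{o_i}(\xi_j^i)\prod_{(k,l)\in\mathcal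 I}(V_j^{kl})^{r_{kl}} .$$ **Theorem.** There is a universal constant $\tilde c>0$ (depending on none of the above data) such that, under (A1)–(A3), $f(X_{\Delta,T})-\tilde M^{(2)}_{\Delta,T}$ is square integrable and $$\operatorname{Var}\bigl[f(X_{\Delta,T})-\tilde M^{(2)}_{\Delta,T}\bigr]\le J\left((c_m-1)\,c_m\,\tilde c\,A^2(\log N+1)\frac KN+\frac{8\,C_\kappa}{K^\kappa}\,\tilde c_m\right).$$ -/

import Mathlib

open MeasureTheory ProbabilityTheory

namespace SRCV

/-- The index set of pairs `(k, l)` with `k < l`. -/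
abbrev Pairs (m : ℕ) : Type := {p : Fin m × Fin m // p.1 < p.2}

/-- A value `(y, z)` of the innovation `(ξ_j, V_j)` of one time step of the second order scheme. -/
abbrev Noise (m : ℕ) : Type := (Fin m → ℝ) × (Pairs m → ℝ)

/-- The set `{-√3, 0, √3}^m × {-1, 1}^(Pairs m)` of the `c_m` scenarios of one time step. -/
noncomputable def grid (m : ℕ) : Finset (Noise m) :=
  (Fintype.piFinset fun _ => ({-√3, 0, √3} : Finset ℝ)) ×ˢ
    (Fintype.piFinset fun _ => ({-1, 1} : Finset ℝ))

/-- The number of scenarios, `c_m = 3^m 2^(m(m-1)/2)`. -/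
def scenarioCount (m : ℕ) : ℕ := 3 ^ m * 2 ^ (m * (m - 1) / 2)

open Classical in
/-- The scenario probability `p_m(y) = 4^(#{i : y_i = 0}) / (6^m 2^(m(m-1)/2))`. -/
noncomputable def prob (m : ℕ) (y : Fin m → ℝ) : ℝ :=
  4 ^ (Finset.univ.filter fun i => y i = 0).card / (6 ^ m * 2 ^ (m * (m - 1) / 2))

/-- `H_0(t) = 1`, `H_1(t) = t`, `H_2(t) = (t² - 1) / √2`. -/
noncomputable def hermite : Fin 3 → ℝ → ℝ
  | 0, _ => 1
  | 1, t => t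
  | 2, t => (t ^ 2 - 1) / √2

/-- Multi-indices `(o, r) ∈ {0,1,2}^m × {0,1}^(Pairs m)`. -/
abbrev MultiIndex (m : ℕ) : Type := (Fin m → Fin 3) × (Pairs m → Fin 2)

/-- The set `𝒰` of multi-indices `(o, r) ≠ (0, 0)`. -/
def indexSet (m : ℕ) : Finset (MultiIndex m) :=
  Finset.univ.filter fun b => (∃ i, b.1 i ≠ 0) ∨ (∃ p, b.2 p ≠ 0)

/-- `∏_i H_{o_i}(y_i) · ∏_{k<l} z_{kl}^{r_{kl}}`. -/
noncomputable def chaos {m : ℕ} (b : MultiIndex m) (w : Noise m) : ℝ :=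
  (∏ i, hermite (b.1 i) (w.1 i)) * ∏ p, w.2 p ^ (b.2 p : ℕ)

/-- `ζ a = (ξ_a, V_a)`, `a ∈ ι`, are independent; for every `a` the vectors `ξ_a` and `V_a` are
independent, the coordinates of `ξ_a` are independent with
`P(ξ_a^k = ±√3) = 1/6`, `P(ξ_a^k = 0) = 2/3`,
and the coordinates of `V_a` are independent with `P(V_a^{kl} = ±1) = 1/2`. -/
structure IsInnovation {Ω ι : Type*} [MeasurableSpace Ω] {m : ℕ}
    (ζ : ι → Ω → Noise m) (P : Measure Ω) : Prop where
  measurable : ∀ a, Measurable (ζ a)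
  indep : iIndepFun ζ P
  indep_fst_snd : ∀ a, IndepFun (fun ω => (ζ a ω).1) (fun ω => (ζ a ω).2) P
  indep_fst : ∀ a, iIndepFun (fun k ω => (ζ a ω).1 k) P
  indep_snd : ∀ a, iIndepFun (fun p ω => (ζ a ω).2 p) P
  fst_pos : ∀ a k, P {ω | (ζ a ω).1 k = √3} = 1 / 6
  fst_neg : ∀ a k, P {ω | (ζ a ω).1 k = -√3} = 1 / 6
  fst_zero : ∀ a k, P {ω | (ζ a ω).1 k = 0} = 2 / 3
  snd_pos : ∀ a p, P {ω | (ζ a ω).2 p = 1} = 1 / 2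
  snd_neg : ∀ a p, P {ω | (ζ a ω).2 p = -1} = 1 / 2

/-- The path `(X_j)_{j = 0, …, J}` of the scheme `X_j = Φ(X_{j-1}, ξ_j, V_j)` that starts at the
grid point `s` in `x` (and rests in `x` before `s`). The innovation of the step from
`j.castSucc` to `j.succ` is `w j`. -/
def pathFrom {d m J : ℕ} (Φ : (Fin d → ℝ) → Noise m → (Fin d → ℝ)) (w : Fin J → Noise m)
    (s : Fin (J + 1)) (x : Fin d → ℝ) : Fin (J + 1) → (Fin d → ℝ) :=
  Fin.induction x fun j X => if s ≤ j.castSucc then Φ X (w j) else x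

/-- The path of the scheme started at time `0` in `x₀`. -/
def schemePath {d m J : ℕ} (Φ : (Fin d → ℝ) → Noise m → (Fin d → ℝ)) (x₀ : Fin d → ℝ)
    (w : Fin J → Noise m) : Fin (J + 1) → (Fin d → ℝ) :=
  pathFrom Φ w 0 x₀

section Target

variable {Ω : Type*} [MeasurableSpace Ω] {d m J : ℕ}

/-- `q_j(x) = E[f(X_J) | X_j = x]`, in the version given by the Markov property for every `x`:
the expectation of `f` at the terminal point of the scheme started at step `j` in `x`. -/
noncomputable def qFun (P : Measure Ω) (ζ : Fin J → Ω → Noise m)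
    (Φ : (Fin d → ℝ) → Noise m → (Fin d → ℝ)) (f : (Fin d → ℝ) → ℝ)
    (j : Fin (J + 1)) (x : Fin d → ℝ) : ℝ :=
  ∫ ω, f (pathFrom Φ (fun i => ζ i ω) j x (Fin.last J)) ∂P

/-- `h_{j,y,z}(x) = q_j(Φ(x, y, z))`, for the step `j` from `j.castSucc` to `j.succ`. -/
noncomputable def hFun (P : Measure Ω) (ζ : Fin J → Ω → Noise m)
    (Φ : (Fin d → ℝ) → Noise m → (Fin d → ℝ)) (f : (Fin d → ℝ) → ℝ)
    (j : Fin J) (w : Noise m) (x : Fin d → ℝ) : ℝ :=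
  qFun P ζ Φ f j.succ (Φ x w)

/-- The law of the scheme at the beginning of step `j`. -/
noncomputable def stateLaw (P : Measure Ω) (ζ : Fin J → Ω → Noise m)
    (Φ : (Fin d → ℝ) → Noise m → (Fin d → ℝ)) (x₀ : Fin d → ℝ) (j : Fin J) :
    Measure (Fin d → ℝ) :=
  P.map fun ω => schemePath Φ x₀ (fun i => ζ i ω) j.castSucc

end Target

/-- Training data: the innovations along `N` paths; together with the fixed starting point they
determine the training paths and the scenario in which each of their steps lies. -/
abbrev Training (m J N : ℕ) : Type := Fin N → Fin J → Noise m

/-- The linear combination `α_1 ψ_1 + … + α_K ψ_K`. -/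
def linComb {d K : ℕ} (ψ : Fin K → (Fin d → ℝ) → ℝ) (α : Fin K → ℝ) (x : Fin d → ℝ) : ℝ :=
  ∑ k, α k * ψ k x

open Classical in
/-- The residual sum of squares of `α_1 ψ_1 + … + α_K ψ_K` in the regression of `g(X_j)` on
`X_{j-1}` over those training paths whose `j`-th innovation equals `w = (y, z)`. -/
noncomputable def rss {d m J N K : ℕ} (Φ : (Fin d → ℝ) → Noise m → (Fin d → ℝ))
    (x₀ : Fin d → ℝ) (ψ : Fin K → (Fin d → ℝ) → ℝ) (g : (Fin d → ℝ) → ℝ)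
    (D : Training m J N) (j : Fin J) (w : Noise m) (α : Fin K → ℝ) : ℝ :=
  ∑ i ∈ Finset.univ.filter (fun i => D i j = w),
    (linComb ψ α (schemePath Φ x₀ (D i) j.castSucc) - g (schemePath Φ x₀ (D i) j.succ)) ^ 2

/-- The truncation operator `T_A`. -/
noncomputable def trunc (A t : ℝ) : ℝ := if |t| ≤ A then t else A * Real.sign t

/-- The estimate `ã_{j,o,r}(x)`, that is, `∑_{y,z} p_m(y) ∏ H_{o_i}(y_i) ∏ z_{kl}^{r_{kl}} h̃_{j,y,z}(x)`
with the truncated regression functions `h̃_{j,y,z} = T_A ĥ_{j,y,z}`, where `α w` are the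
coefficients of `ĥ_{j,w}`, `w = (y, z)`. -/
noncomputable def aTilde {d m K : ℕ} (ψ : Fin K → (Fin d → ℝ) → ℝ) (A : ℝ)
    (α : Noise m → Fin K → ℝ) (b : MultiIndex m) (x : Fin d → ℝ) : ℝ :=
  ∑ w ∈ grid m, prob m w.1 * chaos b w * trunc A (linComb ψ (α w) x)

/-- The control variate
`∑_j ∑_{(o,r) ∈ 𝒰} ã_{j,o,r}(X_{j-1}) ∏ H_{o_i}(ξ_j^i) ∏ (V_j^{kl})^{r_{kl}}`
along the testing path with innovations `w`, with the regression coefficients `α`. -/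
noncomputable def controlVariate {d m J K : ℕ} (Φ : (Fin d → ℝ) → Noise m → (Fin d → ℝ))
    (x₀ : Fin d → ℝ) (ψ : Fin K → (Fin d → ℝ) → ℝ) (A : ℝ)
    (α : Fin J → Noise m → Fin K → ℝ) (w : Fin J → Noise m) : ℝ :=
  ∑ j, ∑ b ∈ indexSet m, aTilde ψ A (α j) b (schemePath Φ x₀ w j.castSucc) * chaos b (w j)

end SRCV

open SRCV

/-! All randomness sits on finitely many atoms of positive probability, so every expectation becomes
a finite sum weighted by `prodWt`.

Martingale part. The chaos polynomials are complete on the scenarios (`prob_mul_sum_chaos`), hence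
each summand of the control variate is the truncated regression function at the drawn scenario minus
its mean over scenarios (`sum_aTilde_mul_chaos`). By the backward recursion for `q_j`, `f(X_J)`
minus its mean is the same sum with the true `h`. The difference is thus a sum of martingale
differences built from the errors `h - h̃`. Orthogonality, and then dropping the centring, bounds
the variance by the sum over steps `j` and scenarios `v` of `p_v` times the mean squared error
(`sum_prodWt_terminal_sub_sq_le`).

Regression part. Given the scenario, the response `q_j(X_j)` equals `h(X_{j-1})` exactly, so the
regression has no noise. The empirical error of the least squares fit is at most that of any fixed
element of the span, and truncation only lowers it. The population error exceeds twice the empirical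
error, on average, by at most `4 A² log S / (N log (3/2))`: symmetrization with a ghost sample
(`sum_prodWt_probability_sub_le`) and a layer cake argument. Here `S` counts traces of superlevel
sets on `2N` points; Sauer-Shelah and the dimension `K` of the coefficient space give `S =
(2N+1)^(2K)` (`card_linTraces_le`, `exists_traces_trunc`). Summing over scenarios yields `2 C_κ
K^(-κ)` plus `c_m` times the deviation term, which is below the stated bound for `m ≥ 1`. For `m =
0` both sides vanish. -/

namespace SRCV

/-! ### Finite product laws and resampling of one coordinate -/

section ProductWeight

variable {ι G : Type*} [Fintype ι]

/-- The weight of a family of independent draws with the weights `p`. -/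
def prodWt (p : G → ℝ) (w : ι → G) : ℝ := ∏ i, p (w i)

theorem prodWt_nonneg {p : G → ℝ} (hp : ∀ x, 0 ≤ p x) (w : ι → G) : 0 ≤ prodWt p w :=
  Finset.prod_nonneg fun _ _ => hp _

theorem prodWt_pos {p : G → ℝ} (hp : ∀ x, 0 < p x) (w : ι → G) : 0 < prodWt p w :=
  Finset.prod_pos fun _ _ => hp _

variable [DecidableEq ι]

theorem sum_prodWt [Fintype G] {p : G → ℝ} (h1 : ∑ x, p x = 1) : ∑ w : ι → G, prodWt p w = 1 := by
  have h := Finset.prod_univ_sum (fun _ : ι => (Finset.univ : Finset G)) (fun _ x => p x)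
  simp only [h1, Finset.prod_const_one, Fintype.piFinset_univ] at h
  exact h.symm

theorem prodWt_update_mul (p : G → ℝ) (w : ι → G) (i : ι) (v : G) :
    prodWt p (Function.update w i v) * p (w i) = prodWt p w * p v := by
  unfold prodWt
  rw [← Finset.mul_prod_erase _ _ (Finset.mem_univ i),
    ← Finset.mul_prod_erase _ (fun k => p (w k)) (Finset.mem_univ i)]
  have : ∏ x ∈ Finset.univ.erase i, p (Function.update w i v x)
      = ∏ x ∈ Finset.univ.erase i, p (w x) := by
    refine Finset.prod_congr rfl fun k hk => ?_
    rw [Function.update_of_ne (Finset.ne_of_mem_erase hk)]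
  rw [this, Function.update_self]
  ring

/-- Resampling one coordinate does not change an expectation. -/
theorem sum_prodWt_update [Fintype G] {p : G → ℝ} (h1 : ∑ x, p x = 1) (i : ι) (F : (ι → G) → ℝ) :
    ∑ w, prodWt p w * F w
      = ∑ w : ι → G, prodWt p w * ∑ v, p v * F (Function.update w i v) := by
  have hl : ∑ w, prodWt p w * F w
      = ∑ a : (ι → G) × G, prodWt p a.1 * p a.2 * F a.1 := by
    rw [Fintype.sum_prod_type]
    refine Finset.sum_congr rfl fun w _ => ?_
    dsimp only
    rw [← Finset.sum_mul, ← Finset.mul_sum, h1, mul_one]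
  have hr : ∑ w : ι → G, prodWt p w * ∑ v, p v * F (Function.update w i v)
      = ∑ a : (ι → G) × G, prodWt p a.1 * p a.2 * F (Function.update a.1 i a.2) := by
    rw [Fintype.sum_prod_type]
    refine Finset.sum_congr rfl fun w _ => ?_
    rw [Finset.mul_sum]
    exact Finset.sum_congr rfl fun v _ => by ring
  rw [hl, hr]
  refine Finset.sum_nbij' (fun a => (Function.update a.1 i a.2, a.1 i))
    (fun a => (Function.update a.1 i a.2, a.1 i)) (by simp) (by simp) (by simp) (by simp) ?_
  rintro ⟨w, v⟩ -
  simp [prodWt_update_mul]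

theorem sum_prodWt_apply [Fintype G] {p : G → ℝ} (h1 : ∑ x, p x = 1) (i : ι) (F : G → ℝ) :
    ∑ w : ι → G, prodWt p w * F (w i) = ∑ v, p v * F v := by
  rw [sum_prodWt_update h1 i]
  simp only [Function.update_self]
  rw [← Finset.sum_mul, sum_prodWt h1, one_mul]

end ProductWeight

/-! ### Symmetrization: population error against twice the empirical error -/

section Symmetrization

/-- Exchange of the `i`-th draws of two samples for all `i` with `σ i = true`. -/
def swapSample {N : ℕ} {W : Type*} (σ : Fin N → Bool) (a : (Fin N → W) × (Fin N → W)) :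
    (Fin N → W) × (Fin N → W) :=
  (fun i => bif σ i then a.2 i else a.1 i, fun i => bif σ i then a.1 i else a.2 i)

theorem swapSample_swapSample {N : ℕ} {W : Type*} (σ : Fin N → Bool)
    (a : (Fin N → W) × (Fin N → W)) : swapSample σ (swapSample σ a) = a := by
  refine Prod.ext ?_ ?_ <;> funext i <;> cases h : σ i <;> simp [swapSample, h]

open Classical in
/-- The indicator of a proposition. -/
noncomputable def ind (p : Prop) : ℝ := if p then 1 else 0

theorem ind_true {p : Prop} (h : p) : ind p = 1 := if_pos h
theorem ind_false {p : Prop} (h : ¬ p) : ind p = 0 := if_neg h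

variable {N : ℕ}

/-- The signed count of the ghost sample against twice the sample, after an exchange. -/
noncomputable def signedCount (T : Finset (Fin N × Bool)) (σ : Fin N → Bool) : ℝ :=
  ∑ i, (ind ((i, !σ i) ∈ T) - 2 * ind ((i, σ i) ∈ T))

/-- The sum factorizes over `i`. With `x = 3/2` a factor is `2/x = 4/3`, `x + 1/x² = 35/18` or `2`,
according as both, one or none of the two points lie in `T`. The weight 2 on the sample itself makes
an `x > 1` with `x + 1/x² ≤ 2` possible. -/
theorem sum_exp_signedCount_le (T : Finset (Fin N × Bool)) :
    ∑ σ : Fin N → Bool, Real.exp (Real.log (3 / 2) * signedCount T σ) ≤ 2 ^ N := by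
  have hexp : ∀ σ : Fin N → Bool, Real.exp (Real.log (3 / 2) * signedCount T σ)
      = ∏ i, Real.exp (Real.log (3 / 2) * (ind ((i, !σ i) ∈ T) - 2 * ind ((i, σ i) ∈ T))) := by
    intro σ
    rw [← Real.exp_sum, signedCount, Finset.mul_sum]
  simp only [hexp]
  have h := Finset.prod_univ_sum (fun _ : Fin N => (Finset.univ : Finset Bool))
    (fun i s => Real.exp (Real.log (3 / 2) * (ind ((i, !s) ∈ T) - 2 * ind ((i, s) ∈ T))))
  rw [Fintype.piFinset_univ] at h
  rw [← h]
  refine (Finset.prod_le_prod (g := fun _ => (2 : ℝ))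
    (fun i _ => Finset.sum_nonneg fun _ _ => (Real.exp_pos _).le) fun i _ => ?_).trans (by simp)
  have e1 : Real.exp (Real.log (3 / 2)) = 3 / 2 := Real.exp_log (by norm_num)
  have e2 : Real.exp (-Real.log (3 / 2)) = 2 / 3 := by
    rw [Real.exp_neg, e1]; norm_num
  have e3 : Real.exp (-(Real.log (3 / 2) * 2)) = 4 / 9 := by
    rw [show -(Real.log (3 / 2) * 2) = -Real.log (3 / 2) + -Real.log (3 / 2) by ring,
      Real.exp_add, e2]; norm_num
  rw [Fintype.sum_bool]
  by_cases ht : (i, true) ∈ T <;> by_cases hf : (i, false) ∈ T <;>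
    simp only [Bool.not_true, Bool.not_false, ind_true, ind_false, ht, hf, not_false_eq_true]
  · norm_num [e2]
  · norm_num [e1, e3]
  · norm_num [e1, e3]
  · norm_num

/-- Jensen's inequality for the uniform mean, through the tangent of `exp` at `log S`. -/
theorem sum_le_log_of_exp {ι : Type*} [Fintype ι] (Z : ι → ℝ) {n S : ℝ} (hS : 0 < S)
    (hn : (Fintype.card ι : ℝ) = n) (h : ∑ x, Real.exp (Z x) ≤ n * S) :
    ∑ x, Z x ≤ n * Real.log S := by
  have h1 : ∀ x, Z x ≤ Real.log S - 1 + Real.exp (Z x) / S := by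
    intro x
    have := Real.add_one_le_exp (Z x - Real.log S)
    rw [Real.exp_sub, Real.exp_log hS] at this
    linarith
  calc ∑ x, Z x ≤ ∑ x, (Real.log S - 1 + Real.exp (Z x) / S) :=
        Finset.sum_le_sum fun x _ => h1 x
    _ = n * (Real.log S - 1) + (∑ x, Real.exp (Z x)) / S := by
        rw [Finset.sum_add_distrib, Finset.sum_const, Finset.card_univ, nsmul_eq_mul, hn,
          Finset.sum_div]
    _ ≤ n * (Real.log S - 1) + n := by
        have : (∑ x, Real.exp (Z x)) / S ≤ n := (div_le_iff₀ hS).2 h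
        linarith
    _ = n * Real.log S := by ring

variable {W : Type*} [Fintype W]

open Classical in
/-- If the sets `C D`, indexed by the samples `D`, have at most `S` traces on any `2 N` points,
then, on average, the probability of the random set `C D` is at most twice its empirical
probability plus `log S / (N log (3/2))`. -/
theorem sum_prodWt_probability_sub_le {p : W → ℝ} (hp : ∀ x, 0 ≤ p x) (h1 : ∑ x, p x = 1)
    (C : (Fin N → W) → W → Prop) {S : ℕ}
    (hS : ∀ z : Fin N × Bool → W, ∃ 𝒯 : Finset (Finset (Fin N × Bool)), 𝒯.card ≤ S ∧
      ∀ D, (Finset.univ.filter fun a => C D (z a)) ∈ 𝒯) :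
    ∑ D : Fin N → W, prodWt p D *
        (N * ∑ x, p x * ind (C D x) - 2 * ∑ i, ind (C D (D i)))
      ≤ Real.log S / Real.log (3 / 2) := by
  have hlam : 0 < Real.log (3 / 2) := Real.log_pos (by norm_num)
  let wt : (Fin N → W) × (Fin N → W) → ℝ := fun a => prodWt p a.1 * prodWt p a.2
  have hwt : ∀ a, 0 ≤ wt a := fun a => mul_nonneg (prodWt_nonneg hp _) (prodWt_nonneg hp _)
  have hwt1 : ∑ a, wt a = 1 := by
    rw [Fintype.sum_prod_type]
    simp only [wt, ← Finset.mul_sum, sum_prodWt h1, mul_one]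
  let Z : (Fin N → W) × (Fin N → W) → ℝ := fun a =>
    ∑ i, (ind (C a.1 (a.2 i)) - 2 * ind (C a.1 (a.1 i)))
  have hlhs : ∑ D : Fin N → W, prodWt p D *
        (N * ∑ x, p x * ind (C D x) - 2 * ∑ i, ind (C D (D i))) = ∑ a, wt a * Z a := by
    rw [Fintype.sum_prod_type]
    refine Finset.sum_congr rfl fun D _ => ?_
    have : ∀ i : Fin N, ∑ D' : Fin N → W, prodWt p D' * ind (C D (D' i))
        = ∑ x, p x * ind (C D x) := fun i => sum_prodWt_apply h1 i fun x => ind (C D x)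
    have h2 : ∑ D' : Fin N → W, prodWt p D' * Z (D, D')
        = N * ∑ x, p x * ind (C D x) - 2 * ∑ i, ind (C D (D i)) := by
      simp only [Z, Finset.sum_sub_distrib, mul_sub]
      rw [← Finset.sum_mul, sum_prodWt h1, one_mul, ← Finset.mul_sum]
      congr 1
      simp only [Finset.mul_sum]
      rw [Finset.sum_comm]
      simp only [this, Finset.sum_const, Finset.card_univ, Fintype.card_fin, nsmul_eq_mul,
        ← Finset.mul_sum]
    rw [← h2, Finset.mul_sum]
    exact Finset.sum_congr rfl fun D' _ => by simp only [wt]; ring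
  -- Sample and ghost sample are i.i.d., so exchanging their `i`-th draws preserves the product
  -- weight.
  have hswap : ∀ σ : Fin N → Bool, ∑ a, wt a * Z (swapSample σ a) = ∑ a, wt a * Z a := by
    intro σ
    refine Finset.sum_nbij' (swapSample σ) (swapSample σ) (by simp) (by simp)
      (fun a _ => swapSample_swapSample σ a) (fun a _ => swapSample_swapSample σ a) ?_
    intro a _
    congr 1
    simp only [wt, prodWt, ← Finset.prod_mul_distrib]
    refine Finset.prod_congr rfl fun i _ => ?_
    cases h : σ i <;> simp [swapSample, h, mul_comm]
  -- With the `2N` points fixed, the exchange changes the trace of `C D` only within `𝒯`. The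
  -- exponential at this random trace is at most the sum over all of `𝒯`, where each trace no longer
  -- depends on `σ`.
  have hpt : ∀ a, ∑ σ, Real.log (3 / 2) * Z (swapSample σ a) ≤ 2 ^ N * Real.log S := by
    intro a
    obtain ⟨𝒯, hc, hmem⟩ := hS fun b => bif b.2 then a.2 b.1 else a.1 b.1
    have hSpos : (0 : ℝ) < S := by
      have : 0 < 𝒯.card := Finset.card_pos.2 ⟨_, hmem a.1⟩
      exact_mod_cast this.trans_le hc
    refine sum_le_log_of_exp _ hSpos (by simp) ?_
    calc ∑ σ, Real.exp (Real.log (3 / 2) * Z (swapSample σ a))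
        ≤ ∑ σ : Fin N → Bool, ∑ T ∈ 𝒯, Real.exp (Real.log (3 / 2) * signedCount T σ) := by
          refine Finset.sum_le_sum fun σ _ => ?_
          have : Z (swapSample σ a) = signedCount (Finset.univ.filter fun b =>
              C (swapSample σ a).1 (bif b.2 then a.2 b.1 else a.1 b.1)) σ := by
            refine Finset.sum_congr rfl fun i _ => ?_
            simp only [Finset.mem_filter, Finset.mem_univ, true_and]
            cases h : σ i <;> simp [swapSample, h]
          rw [this]
          exact Finset.single_le_sum
            (f := fun T => Real.exp (Real.log (3 / 2) * signedCount T σ))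
            (fun T _ => (Real.exp_pos _).le) (hmem _)
      _ = ∑ T ∈ 𝒯, ∑ σ : Fin N → Bool, Real.exp (Real.log (3 / 2) * signedCount T σ) :=
          Finset.sum_comm
      _ ≤ ∑ T ∈ 𝒯, (2 : ℝ) ^ N := Finset.sum_le_sum fun T _ => sum_exp_signedCount_le T
      _ = 𝒯.card * 2 ^ N := by simp
      _ ≤ 2 ^ N * S := by
          rw [mul_comm]; gcongr
  rw [hlhs, le_div_iff₀ hlam]
  have h2N : (0 : ℝ) < 2 ^ N := by positivity
  refine le_of_mul_le_mul_left ?_ h2N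
  calc (2 : ℝ) ^ N * ((∑ a, wt a * Z a) * Real.log (3 / 2))
      = ∑ σ : Fin N → Bool, (∑ a, wt a * Z (swapSample σ a)) * Real.log (3 / 2) := by
        simp [hswap]
    _ = ∑ a, wt a * ∑ σ, Real.log (3 / 2) * Z (swapSample σ a) := by
        simp only [Finset.sum_mul, Finset.mul_sum]
        rw [Finset.sum_comm]
        exact Finset.sum_congr rfl fun a _ => Finset.sum_congr rfl fun σ _ => by ring
    _ ≤ ∑ a, wt a * (2 ^ N * Real.log S) :=
        Finset.sum_le_sum fun a _ => mul_le_mul_of_nonneg_left (hpt a) (hwt a)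
    _ = 2 ^ N * Real.log S := by rw [← Finset.sum_mul, hwt1, one_mul]

/-- Layer cake: a linear inequality for all superlevel sets is inherited by the functions. -/
theorem sum_mul_le_of_superlevel {κ : Type*} [Fintype κ] (c e : κ → ℝ) {B M : ℝ} (hB : 0 ≤ B)
    (h0 : ∀ k, 0 ≤ e k) (hle : ∀ k, e k ≤ B)
    (h : ∀ t, 0 ≤ t → ∑ k, c k * ind (t < e k) ≤ M) : ∑ k, c k * e k ≤ B * M := by
  have hind : ∀ k, (fun t => ind (t < e k)) = (Set.Iio (e k)).indicator 1 := by
    intro k; funext t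
    by_cases ht : t < e k <;> simp [ind, ht]
  have hint : ∀ k, IntervalIntegrable (fun t => ind (t < e k)) volume 0 B := by
    intro k
    rw [hind, intervalIntegrable_iff]
    exact (integrableOn_const (by simp)).indicator measurableSet_Iio
  have hval : ∀ k, ∫ t in (0 : ℝ)..B, ind (t < e k) = e k := by
    intro k
    rw [intervalIntegral.integral_of_le hB, hind, integral_indicator_one measurableSet_Iio,
      measureReal_restrict_apply measurableSet_Iio, measureReal_congr
        (t := Set.Ioo 0 (e k)) ?_]
    · simp [h0 k]
    · have : Set.Iio (e k) ∩ Set.Ioc 0 B = Set.Ioo 0 (e k) := by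
        ext t
        simp only [Set.mem_inter_iff, Set.mem_Iio, Set.mem_Ioc, Set.mem_Ioo]
        constructor
        · rintro ⟨a, b, _⟩; exact ⟨b, a⟩
        · rintro ⟨a, b⟩; exact ⟨b, a, b.le.trans (hle k)⟩
      rw [this]
      exact Filter.EventuallyEq.rfl
  calc ∑ k, c k * e k = ∫ t in (0 : ℝ)..B, ∑ k, c k * ind (t < e k) := by
        rw [intervalIntegral.integral_finsetSum fun k _ => (hint k).const_mul _]
        simp only [intervalIntegral.integral_const_mul, hval]
    _ ≤ ∫ _ in (0 : ℝ)..B, M := by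
        refine intervalIntegral.integral_mono_on hB ?_ (by simp) fun t ht => h t ht.1
        have := IntervalIntegrable.sum Finset.univ fun k _ => (hint k).const_mul (c k)
        rwa [show ∑ k, (fun t => c k * ind (t < e k)) = fun t => ∑ k, c k * ind (t < e k) by
          funext t; simp] at this
    _ = B * M := by simp

-- The difference is linear in `e`, with coefficients of both signs, so the bound for the sets `{t <
-- e D}` integrates over `t` in `[0, B]`.
open Classical in
theorem sum_prodWt_expectation_sub_le {p : W → ℝ} (hp : ∀ x, 0 ≤ p x) (h1 : ∑ x, p x = 1)
    (e : (Fin N → W) → W → ℝ) {B : ℝ} (hB : 0 ≤ B) (h0 : ∀ D x, 0 ≤ e D x)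
    (hle : ∀ D x, e D x ≤ B) {S : ℕ}
    (hS : ∀ t, 0 ≤ t → ∀ z : Fin N × Bool → W, ∃ 𝒯 : Finset (Finset (Fin N × Bool)),
      𝒯.card ≤ S ∧ ∀ D, (Finset.univ.filter fun a => t < e D (z a)) ∈ 𝒯) :
    ∑ D : Fin N → W, prodWt p D * (N * ∑ x, p x * e D x - 2 * ∑ i, e D (D i))
      ≤ B * (Real.log S / Real.log (3 / 2)) := by
  -- Population and empirical sums are merged into one signed sum over `W ⊕ Fin N`, the form
  -- required by `sum_mul_le_of_superlevel`.
  have key : ∀ E : (Fin N → W) → W → ℝ,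
      ∑ D : Fin N → W, prodWt p D * (N * ∑ x, p x * E D x - 2 * ∑ i, E D (D i))
        = ∑ k : (Fin N → W) × (W ⊕ Fin N),
          Sum.elim (fun x => prodWt p k.1 * (N * p x)) (fun _ => prodWt p k.1 * (-2)) k.2
            * Sum.elim (fun x => E k.1 x) (fun i => E k.1 (k.1 i)) k.2 := by
    intro E
    rw [Fintype.sum_prod_type]
    refine Finset.sum_congr rfl fun D _ => ?_
    rw [Fintype.sum_sum_type]
    simp only [Sum.elim_inl, Sum.elim_inr, mul_sub, Finset.mul_sum]
    rw [sub_eq_add_neg, ← Finset.sum_neg_distrib]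
    congr 1 <;> exact Finset.sum_congr rfl fun _ _ => by ring
  rw [key]
  refine sum_mul_le_of_superlevel _ _ hB ?_ ?_ fun t ht => ?_
  · rintro ⟨D, x | i⟩ <;> simp [h0]
  · rintro ⟨D, x | i⟩ <;> simp [hle]
  · have := sum_prodWt_probability_sub_le hp h1 (fun D x => t < e D x) (hS t ht)
    rw [key] at this
    refine le_of_eq_of_le (Finset.sum_congr rfl ?_) this
    rintro ⟨D, x | i⟩ - <;> rfl

end Symmetrization

/-! ### Trace counts for linear and truncated linear classes -/

section Traces

variable {ι : Type*} [Fintype ι] {K : ℕ}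

open Classical in
/-- The traces of the sets `{u < g}`, `g` in the span of the columns of `φ`. -/
noncomputable def linTraces (φ : ι → Fin K → ℝ) (u : ι → ℝ) : Finset (Finset ι) :=
  Finset.univ.filter fun T => ∃ α : Fin K → ℝ, ∀ i, i ∈ T ↔ u i < ∑ k, α k * φ i k

theorem mem_linTraces {φ : ι → Fin K → ℝ} {u : ι → ℝ} {T : Finset ι} :
    T ∈ linTraces φ u ↔ ∃ α : Fin K → ℝ, ∀ i, i ∈ T ↔ u i < ∑ k, α k * φ i k := by
  simp [linTraces]

/-- More than `K` vectors `φ i` satisfy a nontrivial relation `∑ c i • φ i = 0`, so `∑ c i (g i - u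
i)` is the same for every `g` in the span. Shattering provides one `g` above `u` exactly where `c >
0` and another exactly where `c < 0`. The first makes the sum nonnegative, the second nonpositive,
and an index with `c ≠ 0` makes one of the two strict. -/
theorem card_le_of_shatters_linTraces [DecidableEq ι] {φ : ι → Fin K → ℝ} {u : ι → ℝ} {s : Finset ι}
    (hs : (linTraces φ u).Shatters s) : s.card ≤ K := by
  by_contra! hK
  obtain ⟨c, hc, i₀, hi₀⟩ : ∃ c : s → ℝ, ∑ i, c i • φ i = 0 ∧ ∃ i, c i ≠ 0 := by
    have : ¬ LinearIndependent ℝ fun i : s => φ i := by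
      intro hli
      have := hli.fintype_card_le_finrank
      simp at this
      omega
    exact Fintype.not_linearIndependent_iff.1 this
  have hzero : ∀ α : Fin K → ℝ, ∑ i : s, c i * ∑ k, α k * φ i k = 0 := by
    intro α
    simp only [Finset.mul_sum]
    rw [Finset.sum_comm]
    refine Finset.sum_eq_zero fun k _ => ?_
    have := congrFun hc k
    simp only [Finset.sum_apply, Pi.smul_apply, smul_eq_mul, Pi.zero_apply] at this
    calc ∑ i : s, c i * (α k * φ i k) = α k * ∑ i : s, c i * φ i k := by
          rw [Finset.mul_sum]; exact Finset.sum_congr rfl fun _ _ => by ring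
      _ = 0 := by rw [this, mul_zero]
  have hpat : ∀ q : s → Prop, ∃ α : Fin K → ℝ, ∀ i : s, q i ↔ u i < ∑ k, α k * φ i k := by
    classical
    intro q
    obtain ⟨T, hT, hsT⟩ := hs (t := (Finset.univ.filter q).map (Function.Embedding.subtype _))
      (by intro x; simp; tauto)
    obtain ⟨α, hα⟩ := mem_linTraces.1 hT
    refine ⟨α, fun i => ?_⟩
    rw [← hα i]
    have := Finset.ext_iff.1 hsT i
    simp at this
    tauto
  obtain ⟨α, hα⟩ := hpat fun i => 0 < c i
  obtain ⟨β, hβ⟩ := hpat fun i => c i < 0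
  have h1 : ∀ i : s, 0 ≤ c i * (∑ k, α k * φ i k - u i) := by
    intro i
    by_cases h : 0 < c i
    · exact mul_nonneg h.le (sub_nonneg.2 ((hα i).1 h).le)
    · have := not_lt.1 fun h' => h ((hα i).2 h')
      exact mul_nonneg_of_nonpos_of_nonpos (not_lt.1 h) (sub_nonpos.2 this)
  have h2 : ∀ i : s, c i * (∑ k, β k * φ i k - u i) ≤ 0 := by
    intro i
    by_cases h : c i < 0
    · exact mul_nonpos_of_nonpos_of_nonneg h.le (sub_nonneg.2 ((hβ i).1 h).le)
    · have := not_lt.1 fun h' => h ((hβ i).2 h')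
      exact mul_nonpos_of_nonneg_of_nonpos (not_lt.1 h) (sub_nonpos.2 this)
  have h3 : ∀ γ : Fin K → ℝ, ∑ i : s, c i * (∑ k, γ k * φ i k - u i) = - ∑ i : s, c i * u i := by
    intro γ
    simp only [mul_sub, Finset.sum_sub_distrib, hzero γ, zero_sub]
  rcases lt_or_gt_of_ne hi₀ with h | h
  · have : ∑ i : s, c i * (∑ k, β k * φ i k - u i) < 0 :=
      Finset.sum_neg' (fun i _ => h2 i) ⟨i₀, Finset.mem_univ _,
        mul_neg_of_neg_of_pos h (sub_pos.2 ((hβ i₀).1 h))⟩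
    have h' := Finset.sum_nonneg fun (i : s) (_ : i ∈ Finset.univ) => h1 i
    rw [h3] at this h'
    linarith
  · have : 0 < ∑ i : s, c i * (∑ k, α k * φ i k - u i) :=
      Finset.sum_pos' (fun i _ => h1 i) ⟨i₀, Finset.mem_univ _,
        mul_pos h (sub_pos.2 ((hα i₀).1 h))⟩
    have h' := Finset.sum_nonpos fun (i : s) (_ : i ∈ Finset.univ) => h2 i
    rw [h3] at this h'
    linarith

theorem sum_choose_le_pow (n K : ℕ) : ∑ k ∈ Finset.Iic K, n.choose k ≤ (n + 1) ^ K := by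
  rw [add_pow, ← Nat.range_succ_eq_Iic]
  refine Finset.sum_le_sum fun k hk => ?_
  have hk : k ≤ K := Nat.lt_succ_iff.1 (Finset.mem_range.1 hk)
  calc n.choose k ≤ n ^ k := Nat.choose_le_pow n k
    _ ≤ n ^ k * 1 ^ (K - k) * K.choose k := by
      simpa using Nat.le_mul_of_pos_right _ (Nat.choose_pos hk)

/-- Sauer-Shelah with VC dimension at most `K`. -/
theorem card_linTraces_le [DecidableEq ι] (φ : ι → Fin K → ℝ) (u : ι → ℝ) :
    (linTraces φ u).card ≤ (Fintype.card ι + 1) ^ K := by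
  refine (Finset.card_le_card_shatterer _).trans (Finset.card_shatterer_le_sum_vcDim.trans ?_)
  refine le_trans ?_ (sum_choose_le_pow _ K)
  refine Finset.sum_le_sum_of_subset (Finset.Iic_subset_Iic.2 ?_)
  exact Finset.sup_le fun s hs => card_le_of_shatters_linTraces (Finset.mem_shatterer.1 hs)

theorem lt_trunc_iff {A c t : ℝ} (hA : 0 < A) (hc : -A ≤ c) :
    c < trunc A t ↔ c < A ∧ c < t := by
  unfold trunc
  split_ifs with h
  · have := abs_le.1 h
    exact ⟨fun h' => ⟨h'.trans_le this.2, h'⟩, fun h' => h'.2⟩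
  · rcases lt_trichotomy t 0 with ht | ht | ht
    · rw [abs_of_neg ht] at h
      rw [Real.sign_of_neg ht]
      exact ⟨fun h' => by linarith, fun h' => by linarith [h'.2]⟩
    · simp [ht, hA.le] at h
    · rw [abs_of_pos ht] at h
      rw [Real.sign_of_pos ht, mul_one]
      exact ⟨fun h' => ⟨h', by linarith⟩, fun h' => h'.1⟩

theorem trunc_neg (A t : ℝ) : trunc A (-t) = -trunc A t := by
  unfold trunc
  rw [abs_neg, Real.sign_neg]
  split_ifs <;> ring

theorem abs_trunc_le {A : ℝ} (hA : 0 < A) (t : ℝ) : |trunc A t| ≤ A := by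
  unfold trunc
  split_ifs with h
  · exact h
  · rw [abs_mul, abs_of_pos hA]
    have : |Real.sign t| ≤ 1 := by
      rcases Real.sign_apply_eq t with h | h | h <;> rw [h] <;> norm_num
    nlinarith

theorem abs_trunc_sub_le {A b : ℝ} (hA : 0 < A) (hb : |b| ≤ A) (t : ℝ) :
    |trunc A t - b| ≤ |t - b| := by
  unfold trunc
  split_ifs with h
  · exact le_rfl
  · have hb := abs_le.1 hb
    rcases lt_trichotomy t 0 with ht | ht | ht
    · rw [abs_of_neg ht] at h
      rw [Real.sign_of_neg ht, abs_of_nonpos (by linarith), abs_of_nonpos (by linarith)]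
      linarith
    · simp [ht, hA.le] at h
    · rw [abs_of_pos ht] at h
      rw [Real.sign_of_pos ht, abs_of_nonneg (by linarith), abs_of_nonneg (by linarith)]
      linarith

/-- Each superlevel set of the squared error is a union of two linear ones, cut by conditions that
do not involve the coefficients. Hence a pair of linear traces determines its trace. -/
theorem lt_sq_trunc_sub_iff {A b s t : ℝ} (hA : 0 < A) (hb : |b| ≤ A) (hs : 0 ≤ s) :
    s < (trunc A t - b) ^ 2 ↔
      (b + √s < A ∧ b + √s < t) ∨ (-b + √s < A ∧ -b + √s < -t) := by
  have hb := abs_le.1 hb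
  have := Real.sqrt_nonneg s
  rw [← lt_trunc_iff hA (by linarith), ← lt_trunc_iff hA (by linarith), trunc_neg,
    ← Real.sqrt_lt_sqrt_iff hs, Real.sqrt_sq_eq_abs, lt_abs]
  · constructor <;> rintro (h | h) <;> first | (left; linarith) | (right; linarith)

end Traces
-- Scenarios of one step and completeness of the chaos polynomials
section Scenarios

/-- The scenarios of one time step, as a type. -/
abbrev Scenario (m : ℕ) : Type := {w : Noise m // w ∈ grid m}

/-- The probabilities of the scenarios. -/
noncomputable def scenarioWt (m : ℕ) (w : Scenario m) : ℝ := prob m w.1.1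

theorem card_pairs (m : ℕ) : Fintype.card (Pairs m) = m * (m - 1) / 2 := by
  rw [Fintype.card_subtype, Finset.card_filter, ← Finset.univ_product_univ,
    Finset.sum_product_right]
  have : ∀ b : Fin m, ∑ a : Fin m, (if a < b then 1 else 0) = (b : ℕ) := by
    intro b
    rw [← Finset.card_filter]
    have : Finset.univ.filter (fun a : Fin m => a < b) = Finset.Iio b := by ext; simp
    rw [this, Fin.card_Iio]
  simp only [this]
  rw [Fin.sum_univ_eq_sum_range (fun i => i), Finset.sum_range_id]

theorem prob_eq_prod (m : ℕ) (y : Fin m → ℝ) :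
    prob m y = (∏ i, if y i = 0 then (2 / 3 : ℝ) else 1 / 6) * ∏ _p : Pairs m, (1 / 2 : ℝ) := by
  have h : ∀ i, (if y i = 0 then (2 / 3 : ℝ) else 1 / 6) = (if y i = 0 then 4 else 1) / 6 := by
    intro i; split_ifs <;> norm_num
  simp only [h, Finset.prod_div_distrib, Finset.prod_const, Finset.card_univ, card_pairs,
    Fintype.card_fin, one_pow, Finset.prod_ite, mul_one]
  rw [prob, div_mul_div_comm, mul_one]

theorem prob_pos (m : ℕ) (y : Fin m → ℝ) : 0 < prob m y := by
  unfold prob; positivity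

theorem scenarioWt_pos {m : ℕ} (w : Scenario m) : 0 < scenarioWt m w := prob_pos _ _

theorem sqrt_three_ne_zero : √(3 : ℝ) ≠ 0 := by positivity

theorem neg_sqrt_three_ne : -√(3 : ℝ) ≠ √3 := by
  have : 0 < √(3 : ℝ) := by positivity
  intro h; linarith

theorem mem_grid {m : ℕ} {w : Noise m} : w ∈ grid m ↔
    (∀ i, w.1 i = -√3 ∨ w.1 i = 0 ∨ w.1 i = √3) ∧ ∀ p, w.2 p = -1 ∨ w.2 p = 1 := by
  simp [grid, Fintype.mem_piFinset]

theorem card_grid (m : ℕ) : (grid m).card = scenarioCount m := by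
  have h3 : ({-√3, 0, √3} : Finset ℝ).card = 3 := by
    rw [Finset.card_eq_three]
    exact ⟨-√3, 0, √3, neg_ne_zero.2 sqrt_three_ne_zero, neg_sqrt_three_ne,
      sqrt_three_ne_zero.symm, rfl⟩
  have h2 : ({-1, 1} : Finset ℝ).card = 2 := by
    rw [Finset.card_eq_two]
    exact ⟨-1, 1, by norm_num, rfl⟩
  simp only [grid, Finset.card_product, Fintype.card_piFinset, h3, h2, Finset.prod_const,
    Finset.card_univ, Fintype.card_fin, card_pairs, scenarioCount]

theorem card_scenario (m : ℕ) : Fintype.card (Scenario m) = scenarioCount m := by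
  rw [Fintype.card_coe, card_grid]

theorem sum_scenarioWt (m : ℕ) : ∑ w, scenarioWt m w = 1 := by
  have h : ∑ w, scenarioWt m w = ∑ w ∈ grid m, prob m w.1 :=
    Finset.sum_coe_sort (grid m) fun w => prob m w.1
  rw [h, grid, Finset.sum_product]
  simp only [prob_eq_prod, ← Finset.mul_sum, ← Finset.sum_mul]
  have h1 := Finset.prod_univ_sum (fun _ : Fin m => ({-√3, 0, √3} : Finset ℝ))
    (fun _ t => if t = 0 then (2 / 3 : ℝ) else 1 / 6)
  rw [Finset.sum_const, nsmul_eq_mul, ← mul_assoc, ← h1, Fintype.card_piFinset]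
  have h3 : ∑ t ∈ ({-√3, 0, √3} : Finset ℝ), (if t = 0 then (2 / 3 : ℝ) else 1 / 6) = 1 := by
    rw [Finset.sum_insert, Finset.sum_insert, Finset.sum_singleton]
    · simp; norm_num
    · simpa using sqrt_three_ne_zero.symm
    · simpa [sqrt_three_ne_zero] using neg_sqrt_three_ne
  have h2 : ({-1, 1} : Finset ℝ).card = 2 := by
    rw [Finset.card_eq_two]
    exact ⟨-1, 1, by norm_num, rfl⟩
  simp only [h3, h2, Finset.prod_const_one, one_mul, Nat.cast_prod]
  rw [← Finset.prod_mul_distrib]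
  norm_num

/-- The `H_o` are orthonormal for the three-point law, and there are as many of them as atoms. The
matrix `√p(t) H_o(t)` is therefore orthogonal, which gives this dual relation; the proof checks the
nine cases. -/
theorem hermite_kernel {s t : ℝ} (hs : s = -√3 ∨ s = 0 ∨ s = √3) (ht : t = -√3 ∨ t = 0 ∨ t = √3) :
    (if t = 0 then (2 / 3 : ℝ) else 1 / 6) * ∑ o : Fin 3, hermite o s * hermite o t
      = if s = t then 1 else 0 := by
  have h3 : √(3 : ℝ) * √3 = 3 := Real.mul_self_sqrt (by norm_num)
  have h2 : √(2 : ℝ) * √2 = 2 := Real.mul_self_sqrt (by norm_num)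
  have hn := sqrt_three_ne_zero
  have hne := neg_sqrt_three_ne
  have e2 : ∀ a b : ℝ, a / √2 * (b / √2) = a * b / 2 := by
    intro a b; rw [div_mul_div_comm, h2]
  rw [Fin.sum_univ_three]
  simp only [hermite, e2]
  rcases hs with rfl | rfl | rfl <;> rcases ht with rfl | rfl | rfl <;>
    simp [hn, hn.symm, hne, hne.symm, pow_two, h3] <;> norm_num

theorem sign_kernel {s t : ℝ} (hs : s = -1 ∨ s = 1) (ht : t = -1 ∨ t = 1) :
    (1 / 2 : ℝ) * ∑ r : Fin 2, s ^ (r : ℕ) * t ^ (r : ℕ) = if s = t then 1 else 0 := by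
  rw [Fin.sum_univ_two]
  rcases hs with rfl | rfl <;> rcases ht with rfl | rfl <;> norm_num

theorem sum_chaos_mul_chaos {m : ℕ} (w w' : Noise m) :
    ∑ b : MultiIndex m, chaos b w * chaos b w'
      = (∏ i, ∑ o : Fin 3, hermite o (w.1 i) * hermite o (w'.1 i))
        * ∏ p, ∑ r : Fin 2, w.2 p ^ (r : ℕ) * w'.2 p ^ (r : ℕ) := by
  have h1 := Finset.prod_univ_sum (fun _ : Fin m => (Finset.univ : Finset (Fin 3)))
    (fun i o => hermite o (w.1 i) * hermite o (w'.1 i))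
  have h2 := Finset.prod_univ_sum (fun _ : Pairs m => (Finset.univ : Finset (Fin 2)))
    (fun p r => w.2 p ^ (r : ℕ) * w'.2 p ^ (r : ℕ))
  rw [Fintype.piFinset_univ] at h1 h2
  rw [h1, h2, Fintype.sum_prod_type, Finset.sum_mul_sum]
  refine Finset.sum_congr rfl fun o _ => Finset.sum_congr rfl fun r _ => ?_
  simp only [chaos, Finset.prod_mul_distrib]
  ring

/-- The chaos polynomials are complete on the grid. -/
theorem prob_mul_sum_chaos {m : ℕ} {w w' : Noise m} (hw : w ∈ grid m) (hw' : w' ∈ grid m) :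
    prob m w'.1 * ∑ b : MultiIndex m, chaos b w * chaos b w' = if w = w' then 1 else 0 := by
  classical
  rw [mem_grid] at hw hw'
  rw [sum_chaos_mul_chaos, prob_eq_prod, mul_mul_mul_comm, ← Finset.prod_mul_distrib,
    ← Finset.prod_mul_distrib]
  simp only [hermite_kernel (hw.1 _) (hw'.1 _), sign_kernel (hw.2 _) (hw'.2 _)]
  rw [Fintype.prod_ite_zero, Fintype.prod_ite_zero]
  simp only [Finset.prod_const_one, Prod.ext_iff, funext_iff]
  split_ifs <;> simp_all

theorem indexSet_eq (m : ℕ) : indexSet m = Finset.univ.erase (fun _ => 0, fun _ => 0) := by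
  ext b
  simp only [indexSet, Finset.mem_filter, Finset.mem_univ, true_and, Finset.mem_erase, and_true,
    ne_eq, Prod.ext_iff, funext_iff, not_and_or, not_forall]

/-- The omitted index `(0, 0)` contributes the constant 1. Leaving it out is what centres the
control variate. -/
theorem sum_indexSet_chaos {m : ℕ} (w w' : Noise m) :
    ∑ b ∈ indexSet m, chaos b w * chaos b w'
      = (∑ b : MultiIndex m, chaos b w * chaos b w') - 1 := by
  rw [indexSet_eq, ← Finset.sum_erase_add _ _ (Finset.mem_univ ((fun _ => 0, fun _ => 0)))]
  simp [chaos, hermite]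

/-- The control variate subtracts, in every step, the centered truncated regression function. -/
theorem sum_aTilde_mul_chaos {d m K : ℕ} (ψ : Fin K → (Fin d → ℝ) → ℝ) (A : ℝ)
    (α : Noise m → Fin K → ℝ) (x : Fin d → ℝ) (w : Scenario m) :
    ∑ b ∈ indexSet m, aTilde ψ A α b x * chaos b w.1
      = trunc A (linComb ψ (α w.1) x)
        - ∑ v, scenarioWt m v * trunc A (linComb ψ (α v.1) x) := by
  classical
  have hc : ∑ v, scenarioWt m v * trunc A (linComb ψ (α v.1) x)
      = ∑ v ∈ grid m, prob m v.1 * trunc A (linComb ψ (α v) x) :=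
    Finset.sum_coe_sort (grid m) fun v => prob m v.1 * trunc A (linComb ψ (α v) x)
  rw [hc]
  calc ∑ b ∈ indexSet m, aTilde ψ A α b x * chaos b w.1
      = ∑ v ∈ grid m, (prob m v.1 * ∑ b ∈ indexSet m, chaos b w.1 * chaos b v)
          * trunc A (linComb ψ (α v) x) := by
        simp only [aTilde, Finset.sum_mul, Finset.mul_sum]
        rw [Finset.sum_comm]
        exact Finset.sum_congr rfl fun _ _ => Finset.sum_congr rfl fun _ _ => by ring
    _ = ∑ v ∈ grid m, ((if w.1 = v then trunc A (linComb ψ (α v) x) else 0)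
          - prob m v.1 * trunc A (linComb ψ (α v) x)) := by
        refine Finset.sum_congr rfl fun v hv => ?_
        rw [sum_indexSet_chaos, mul_sub, prob_mul_sum_chaos w.2 hv]
        split_ifs <;> ring
    _ = _ := by
        rw [Finset.sum_sub_distrib, Finset.sum_ite_eq, if_pos w.2]

end Scenarios

/-! ### Paths of the scheme and the backward recursion -/

section Paths

variable {d m J : ℕ} {Φ : (Fin d → ℝ) → Noise m → (Fin d → ℝ)}

theorem pathFrom_succ (w : Fin J → Noise m) (s : Fin (J + 1)) (x : Fin d → ℝ) (j : Fin J) :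
    pathFrom Φ w s x j.succ
      = if s ≤ j.castSucc then Φ (pathFrom Φ w s x j.castSucc) (w j) else x := by
  simp [pathFrom, Fin.induction_succ]

theorem pathFrom_of_le (w : Fin J → Noise m) {s : Fin (J + 1)} (x : Fin d → ℝ) {k : Fin (J + 1)}
    (hk : k ≤ s) : pathFrom Φ w s x k = x := by
  cases k using Fin.cases with
  | zero => rfl
  | succ j =>
    rw [pathFrom_succ, if_neg]
    exact not_le.2 ((Fin.castSucc_lt_succ (i := j)).trans_le hk)

theorem schemePath_succ (x₀ : Fin d → ℝ) (w : Fin J → Noise m) (j : Fin J) :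
    schemePath Φ x₀ w j.succ = Φ (schemePath Φ x₀ w j.castSucc) (w j) := by
  rw [schemePath, pathFrom_succ, if_pos (Fin.zero_le _)]

theorem pathFrom_congr {w w' : Fin J → Noise m} {s : Fin (J + 1)} (x : Fin d → ℝ)
    (k : Fin (J + 1)) (h : ∀ i : Fin J, s ≤ i.castSucc → i.castSucc < k → w i = w' i) :
    pathFrom Φ w s x k = pathFrom Φ w' s x k := by
  induction k using Fin.induction with
  | zero => rfl
  | succ j ih =>
    rw [pathFrom_succ, pathFrom_succ]
    split_ifs with hs
    · rw [ih fun i hi hij => h i hi (hij.trans Fin.castSucc_lt_succ),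
        h j hs Fin.castSucc_lt_succ]
    · rfl

/-- Flow property: one step, followed by a restart from the point reached. -/
theorem pathFrom_castSucc (w : Fin J → Noise m) (j : Fin J) (x : Fin d → ℝ) (k : Fin (J + 1))
    (hk : j.succ ≤ k) :
    pathFrom Φ w j.castSucc x k = pathFrom Φ w j.succ (Φ x (w j)) k := by
  induction k using Fin.induction with
  | zero => exact absurd hk (not_le.2 (Fin.succ_pos j))
  | succ i ih =>
    have hji : j ≤ i := Fin.succ_le_succ_iff.1 hk
    rcases hji.eq_or_lt with rfl | hlt
    · rw [pathFrom_succ, if_pos le_rfl, pathFrom_of_le _ _ le_rfl, pathFrom_of_le _ _ le_rfl]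
    · have h1 : j.succ ≤ i.castSucc := Fin.succ_le_castSucc_iff.2 hlt
      rw [pathFrom_succ, pathFrom_succ, if_pos h1,
        if_pos (Fin.castSucc_le_castSucc_iff.2 hji), ih h1]

/-- The innovations of a path of scenarios. -/
def noiseOf (w : Fin J → Scenario m) (j : Fin J) : Noise m := (w j).1

theorem noiseOf_update_of_ne (w : Fin J → Scenario m) {i j : Fin J} (v : Scenario m)
    (h : i ≠ j) : noiseOf (Function.update w j v) i = noiseOf w i := by
  rw [noiseOf, Function.update_of_ne h, noiseOf]

/-- Adaptedness: the state at the beginning of step `i ≤ j` does not see the innovation of step `j`.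
-/
theorem schemePath_update (x₀ : Fin d → ℝ) (w : Fin J → Scenario m) {i j : Fin J} (v : Scenario m)
    (h : i ≤ j) : schemePath Φ x₀ (noiseOf (Function.update w j v)) i.castSucc
      = schemePath Φ x₀ (noiseOf w) i.castSucc := by
  refine pathFrom_congr _ _ fun k _ hk => noiseOf_update_of_ne _ _ ?_
  rintro rfl
  exact absurd (Fin.castSucc_lt_castSucc_iff.1 hk) (not_lt.2 h)

/-- The conditional expectation of `f` at the terminal point, as a finite sum. -/
noncomputable def scenarioMean (Φ : (Fin d → ℝ) → Noise m → (Fin d → ℝ)) (f : (Fin d → ℝ) → ℝ)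
    (j : Fin (J + 1)) (x : Fin d → ℝ) : ℝ :=
  ∑ w : Fin J → Scenario m, prodWt (scenarioWt m) w
    * f (pathFrom Φ (noiseOf w) j x (Fin.last J))

theorem scenarioMean_last (f : (Fin d → ℝ) → ℝ) (x : Fin d → ℝ) :
    scenarioMean Φ f (Fin.last J) x = f x := by
  simp only [scenarioMean, pathFrom_of_le _ _ (le_refl (Fin.last J))]
  rw [← Finset.sum_mul, sum_prodWt (sum_scenarioWt m), one_mul]

/-- Resampling the `j`-th innovation separates the first step; the rest of the path uses only later
innovations. -/
theorem scenarioMean_castSucc (f : (Fin d → ℝ) → ℝ) (j : Fin J) (x : Fin d → ℝ) :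
    scenarioMean Φ f j.castSucc x
      = ∑ v, scenarioWt m v * scenarioMean Φ f j.succ (Φ x v.1) := by
  simp only [scenarioMean]
  rw [sum_prodWt_update (sum_scenarioWt m) j]
  simp only [Finset.mul_sum]
  rw [Finset.sum_comm]
  refine Finset.sum_congr rfl fun v _ => Finset.sum_congr rfl fun w _ => ?_
  rw [pathFrom_castSucc _ _ _ _ (Fin.le_last _)]
  have : noiseOf (Function.update w j v) j = v.1 := by simp [noiseOf]
  rw [this, pathFrom_congr (w' := noiseOf w) (Φ x v.1) (Fin.last J) fun i hi _ =>
    noiseOf_update_of_ne w v (fun h => ?_)]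
  · ring
  · subst h
    exact absurd hi (not_le.2 Fin.castSucc_lt_succ)

end Paths

/-! ### Orthogonality of martingale differences -/

section Martingale

variable {G : Type*} [Fintype G] {J : ℕ}

/-- Orthogonality of martingale differences. -/
theorem sum_prodWt_sq_sum {p : G → ℝ} (h1 : ∑ x, p x = 1) (Y : Fin J → (Fin J → G) → ℝ)
    (hadapted : ∀ i j w v, i < j → Y i (Function.update w j v) = Y i w)
    (hcentered : ∀ j w, ∑ v, p v * Y j (Function.update w j v) = 0) :
    ∑ w, prodWt p w * (∑ j, Y j w) ^ 2 = ∑ j, ∑ w, prodWt p w * Y j w ^ 2 := by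
  have hlt : ∀ i j, i < j → ∑ w, prodWt p w * (Y i w * Y j w) = 0 := by
    -- The later coordinate `j` is resampled: `Y i` is unaffected and `Y j` averages to zero.
    intro i j hij
    rw [sum_prodWt_update h1 j]
    refine Finset.sum_eq_zero fun w _ => ?_
    have : ∑ v, p v * (Y i (Function.update w j v) * Y j (Function.update w j v))
        = Y i w * ∑ v, p v * Y j (Function.update w j v) := by
      rw [Finset.mul_sum]
      refine Finset.sum_congr rfl fun v _ => ?_
      rw [hadapted i j w v hij]; ring
    rw [this, hcentered, mul_zero, mul_zero]
  calc ∑ w, prodWt p w * (∑ j, Y j w) ^ 2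
      = ∑ i, ∑ j, ∑ w, prodWt p w * (Y i w * Y j w) := by
        have h : ∀ w, prodWt p w * (∑ j, Y j w) ^ 2 = ∑ i, ∑ j, prodWt p w * (Y i w * Y j w) := by
          intro w
          rw [pow_two, Finset.sum_mul_sum, Finset.mul_sum]
          exact Finset.sum_congr rfl fun i _ => Finset.mul_sum _ _ _
        simp only [h]
        rw [Finset.sum_comm]
        exact Finset.sum_congr rfl fun i _ => Finset.sum_comm
    _ = ∑ i, ∑ w, prodWt p w * (Y i w * Y i w) := by
        refine Finset.sum_congr rfl fun i _ => Finset.sum_eq_single_of_mem i (Finset.mem_univ i)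
          fun j _ hj => ?_
        rcases lt_or_gt_of_ne hj with h | h
        · rw [← hlt j i h]
          exact Finset.sum_congr rfl fun w _ => by ring
        · exact hlt i j h
    _ = _ := by simp only [pow_two]

theorem sum_mul_sub_mean {p : G → ℝ} (h1 : ∑ x, p x = 1) (e : G → ℝ) :
    ∑ v, p v * (e v - ∑ u, p u * e u) = 0 := by
  simp only [mul_sub, Finset.sum_sub_distrib]
  rw [← Finset.sum_mul, h1, one_mul, sub_self]

theorem sum_mul_sub_mean_sq_le {p : G → ℝ} (h1 : ∑ x, p x = 1) (e : G → ℝ) :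
    ∑ v, p v * (e v - ∑ u, p u * e u) ^ 2 ≤ ∑ v, p v * e v ^ 2 := by
  set c := ∑ u, p u * e u with hc
  have : ∑ v, p v * (e v - c) ^ 2 = ∑ v, p v * e v ^ 2 - c ^ 2 := by
    have : ∀ v, p v * (e v - c) ^ 2 = p v * e v ^ 2 - 2 * c * (p v * e v) + c ^ 2 * p v := by
      intro v; ring
    simp only [this, Finset.sum_add_distrib, Finset.sum_sub_distrib, ← Finset.mul_sum, h1, ← hc]
    ring
  rw [this]
  nlinarith [sq_nonneg c]

end Martingale

/-! ### Martingale decomposition of the controlled functional -/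

section Decomposition

variable {d m J : ℕ} (Φ : (Fin d → ℝ) → Noise m → (Fin d → ℝ)) (f : (Fin d → ℝ) → ℝ)
  (x₀ : Fin d → ℝ)

/-- The error of an approximation `g` of the functions `h_{j,y,z}`. -/
noncomputable def approxError (g : Fin J → Scenario m → (Fin d → ℝ) → ℝ) (j : Fin J)
    (v : Scenario m) (x : Fin d → ℝ) : ℝ :=
  scenarioMean Φ f j.succ (Φ x v.1) - g j v x

theorem terminal_sub_eq_sum (g : Fin J → Scenario m → (Fin d → ℝ) → ℝ) (w : Fin J → Scenario m) :
    f (schemePath Φ x₀ (noiseOf w) (Fin.last J))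
        - ∑ j, (g j (w j) (schemePath Φ x₀ (noiseOf w) j.castSucc)
          - ∑ v, scenarioWt m v * g j v (schemePath Φ x₀ (noiseOf w) j.castSucc))
        - scenarioMean (J := J) Φ f 0 x₀
      = ∑ j, (approxError Φ f g j (w j) (schemePath Φ x₀ (noiseOf w) j.castSucc)
          - ∑ v, scenarioWt m v
            * approxError Φ f g j v (schemePath Φ x₀ (noiseOf w) j.castSucc)) := by
  -- Telescoping of `q_k(X_k)` from `q_0(x₀)` to `q_J(X_J) = f(X_J)`.
  have htel : f (schemePath Φ x₀ (noiseOf w) (Fin.last J)) - scenarioMean (J := J) Φ f 0 x₀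
      = ∑ j : Fin J, (scenarioMean Φ f j.succ (schemePath Φ x₀ (noiseOf w) j.succ)
        - scenarioMean Φ f j.castSucc (schemePath Φ x₀ (noiseOf w) j.castSucc)) := by
    have h := Fin.sum_univ_succ fun k => scenarioMean Φ f k (schemePath Φ x₀ (noiseOf w) k)
    rw [Fin.sum_univ_castSucc, scenarioMean_last] at h
    rw [Finset.sum_sub_distrib]
    have h0 : schemePath Φ x₀ (noiseOf w) 0 = x₀ := rfl
    rw [h0] at h
    linarith
  rw [sub_right_comm, htel, ← Finset.sum_sub_distrib]
  refine Finset.sum_congr rfl fun j _ => ?_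
  simp only [approxError, mul_sub, Finset.sum_sub_distrib, schemePath_succ,
    scenarioMean_castSucc f j]
  simp only [noiseOf]
  ring

theorem sum_prodWt_terminal_sub_sq (g : Fin J → Scenario m → (Fin d → ℝ) → ℝ) :
    ∑ w : Fin J → Scenario m, prodWt (scenarioWt m) w *
        (f (schemePath Φ x₀ (noiseOf w) (Fin.last J))
          - ∑ j, (g j (w j) (schemePath Φ x₀ (noiseOf w) j.castSucc)
            - ∑ v, scenarioWt m v * g j v (schemePath Φ x₀ (noiseOf w) j.castSucc))
          - scenarioMean (J := J) Φ f 0 x₀) ^ 2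
      = ∑ j, ∑ w : Fin J → Scenario m, prodWt (scenarioWt m) w *
          (approxError Φ f g j (w j) (schemePath Φ x₀ (noiseOf w) j.castSucc)
          - ∑ v, scenarioWt m v
            * approxError Φ f g j v (schemePath Φ x₀ (noiseOf w) j.castSucc)) ^ 2 := by
  simp only [terminal_sub_eq_sum]
  refine sum_prodWt_sq_sum (sum_scenarioWt m)
    (fun j w => approxError Φ f g j (w j) (schemePath Φ x₀ (noiseOf w) j.castSucc)
          - ∑ v, scenarioWt m v
            * approxError Φ f g j v (schemePath Φ x₀ (noiseOf w) j.castSucc)) ?_ ?_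
  · intro i j w v hij
    simp only [schemePath_update x₀ w v hij.le, Function.update_of_ne hij.ne]
  · intro j w
    simp only [schemePath_update x₀ w _ le_rfl, Function.update_self]
    exact sum_mul_sub_mean (sum_scenarioWt m) _

/-- The `j`-th innovation is independent of the state before it, so it can be averaged first. A
variance over scenarios is at most the second moment. -/
theorem sum_prodWt_terminal_sub_sq_le (g : Fin J → Scenario m → (Fin d → ℝ) → ℝ) :
    ∑ w : Fin J → Scenario m, prodWt (scenarioWt m) w *
        (f (schemePath Φ x₀ (noiseOf w) (Fin.last J))
          - ∑ j, (g j (w j) (schemePath Φ x₀ (noiseOf w) j.castSucc)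
            - ∑ v, scenarioWt m v * g j v (schemePath Φ x₀ (noiseOf w) j.castSucc))
          - scenarioMean (J := J) Φ f 0 x₀) ^ 2
      ≤ ∑ j, ∑ v, scenarioWt m v * ∑ w : Fin J → Scenario m, prodWt (scenarioWt m) w *
          approxError Φ f g j v (schemePath Φ x₀ (noiseOf w) j.castSucc) ^ 2 := by
  rw [sum_prodWt_terminal_sub_sq]
  refine Finset.sum_le_sum fun j _ => ?_
  rw [sum_prodWt_update (sum_scenarioWt m) j]
  have hr : ∀ v, scenarioWt m v * ∑ w : Fin J → Scenario m, prodWt (scenarioWt m) w *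
        approxError Φ f g j v (schemePath Φ x₀ (noiseOf w) j.castSucc) ^ 2
      = ∑ w : Fin J → Scenario m, scenarioWt m v * (prodWt (scenarioWt m) w *
        approxError Φ f g j v (schemePath Φ x₀ (noiseOf w) j.castSucc) ^ 2) :=
    fun v => Finset.mul_sum _ _ _
  simp only [schemePath_update x₀ _ _ le_rfl, Function.update_self, hr]
  rw [Finset.sum_comm (s := Finset.univ (α := Scenario m))]
  refine Finset.sum_le_sum fun w _ => ?_
  have := mul_le_mul_of_nonneg_left (sum_mul_sub_mean_sq_le (sum_scenarioWt m)
    fun v => approxError Φ f g j v (schemePath Φ x₀ (noiseOf w) j.castSucc))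
    (prodWt_nonneg (fun v => (scenarioWt_pos v).le) w)
  refine this.trans (le_of_eq ?_)
  rw [Finset.mul_sum]
  exact Finset.sum_congr rfl fun v _ => by ring

/-- Serves `m = 0`, where the claimed bound is zero and the centring may not be dropped: with a
single scenario every centred term vanishes. -/
theorem sum_prodWt_terminal_sub_sq_eq_zero [Subsingleton (Scenario m)]
    (g : Fin J → Scenario m → (Fin d → ℝ) → ℝ) :
    ∑ w : Fin J → Scenario m, prodWt (scenarioWt m) w *
        (f (schemePath Φ x₀ (noiseOf w) (Fin.last J))
          - ∑ j, (g j (w j) (schemePath Φ x₀ (noiseOf w) j.castSucc)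
            - ∑ v, scenarioWt m v * g j v (schemePath Φ x₀ (noiseOf w) j.castSucc))
          - scenarioMean (J := J) Φ f 0 x₀) ^ 2 = 0 := by
  rw [sum_prodWt_terminal_sub_sq]
  refine Finset.sum_eq_zero fun j _ => Finset.sum_eq_zero fun w _ => ?_
  have : ∀ e : Scenario m → ℝ, ∑ v, scenarioWt m v * e v = e (w j) := by
    intro e
    have : ∀ v, scenarioWt m v * e v = scenarioWt m v * e (w j) := fun v => by
      rw [Subsingleton.elim v (w j)]
    simp only [this]
    rw [← Finset.sum_mul, sum_scenarioWt, one_mul]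
  rw [this, sub_self]
  simp

end Decomposition
-- Error of the truncated least squares estimate
section Regression

variable {d m J N K : ℕ} {Φ : (Fin d → ℝ) → Noise m → (Fin d → ℝ)} {x₀ : Fin d → ℝ}

open Classical in
theorem sum_prodWt_ite (j : Fin J) (v : Scenario m) (F : (Fin d → ℝ) → ℝ) :
    ∑ w : Fin J → Scenario m, prodWt (scenarioWt m) w *
        (if w j = v then F (schemePath Φ x₀ (noiseOf w) j.castSucc) else 0)
      = scenarioWt m v * ∑ w : Fin J → Scenario m, prodWt (scenarioWt m) w *
          F (schemePath Φ x₀ (noiseOf w) j.castSucc) := by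
  rw [sum_prodWt_update (sum_scenarioWt m) j, Finset.mul_sum]
  refine Finset.sum_congr rfl fun w _ => ?_
  simp only [schemePath_update x₀ _ _ le_rfl, Function.update_self, mul_ite, mul_zero,
    Finset.sum_ite_eq', Finset.mem_univ, if_true]
  ring

open Classical in
/-- The traces of the superlevel sets of the squared error of truncated linear combinations. -/
theorem exists_traces_trunc {ι E : Type*} [Fintype ι] {A s : ℝ} (hA : 0 < A) (hs : 0 ≤ s)
    (a : ι → Prop) (φ : ι → Fin K → ℝ) (b : ι → ℝ) (hb : ∀ i, |b i| ≤ A) (α : E → Fin K → ℝ) :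
    ∃ 𝒯 : Finset (Finset ι), 𝒯.card ≤ (Fintype.card ι + 1) ^ K * (Fintype.card ι + 1) ^ K ∧
      ∀ D, (Finset.univ.filter fun i =>
        s < if a i then (trunc A (∑ k, α D k * φ i k) - b i) ^ 2 else 0) ∈ 𝒯 := by
  refine ⟨(linTraces φ (fun i => b i + √s) ×ˢ linTraces φ (fun i => -b i + √s)).image
    fun P => Finset.univ.filter fun i =>
      a i ∧ ((b i + √s < A ∧ i ∈ P.1) ∨ (-b i + √s < A ∧ i ∈ P.2)), ?_, fun D => ?_⟩
  · refine Finset.card_image_le.trans ?_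
    rw [Finset.card_product]
    exact Nat.mul_le_mul (card_linTraces_le _ _) (card_linTraces_le _ _)
  · refine Finset.mem_image.2 ⟨(Finset.univ.filter fun i => b i + √s < ∑ k, α D k * φ i k,
      Finset.univ.filter fun i => -b i + √s < ∑ k, (-α D) k * φ i k), ?_, ?_⟩
    · exact Finset.mem_product.2 ⟨mem_linTraces.2 ⟨α D, by simp⟩,
        mem_linTraces.2 ⟨-α D, by simp⟩⟩
    · ext i
      simp only [Finset.mem_filter, Finset.mem_univ, true_and, Pi.neg_apply, neg_mul,
        Finset.sum_neg_distrib]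
      by_cases h : a i
      · rw [if_pos h, lt_sq_trunc_sub_iff hA (hb i) hs]
        simp [h]
      · simp [h, hs]

/-- The noise-free least squares estimate on the training paths in the scenario `v`, truncated at
the bound `A` of the regression function `q (Φ · v)`. -/
theorem scenarioWt_mul_regression_error_le (hN : 1 ≤ N) (ψ : Fin K → (Fin d → ℝ) → ℝ)
    (q : (Fin d → ℝ) → ℝ) (j : Fin J) (v : Scenario m) {A : ℝ} (hA : 0 < A)
    (hq : ∀ x, |q (Φ x v.1)| ≤ A) (α : (Fin N → Fin J → Scenario m) → Fin K → ℝ)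
    (β : Fin K → ℝ)
    (hα : ∀ D, rss Φ x₀ ψ q (fun i => noiseOf (D i)) j v.1 (α D)
      ≤ rss Φ x₀ ψ q (fun i => noiseOf (D i)) j v.1 β) :
    ∑ D : Fin N → Fin J → Scenario m, prodWt (prodWt (scenarioWt m)) D *
        (scenarioWt m v * ∑ w : Fin J → Scenario m, prodWt (scenarioWt m) w *
          (trunc A (linComb ψ (α D) (schemePath Φ x₀ (noiseOf w) j.castSucc))
            - q (Φ (schemePath Φ x₀ (noiseOf w) j.castSucc) v.1)) ^ 2)
      ≤ 2 * (scenarioWt m v * ∑ w : Fin J → Scenario m, prodWt (scenarioWt m) w *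
          (linComb ψ β (schemePath Φ x₀ (noiseOf w) j.castSucc)
            - q (Φ (schemePath Φ x₀ (noiseOf w) j.castSucc) v.1)) ^ 2)
        + 4 * A ^ 2 * (Real.log (((2 * N + 1) ^ K * (2 * N + 1) ^ K : ℕ) : ℝ)
          / Real.log (3 / 2)) / N := by
  classical
  have hν : ∀ w : Fin J → Scenario m, 0 ≤ prodWt (scenarioWt m) w :=
    prodWt_nonneg fun v => (scenarioWt_pos v).le
  have hν1 : ∑ w : Fin J → Scenario m, prodWt (scenarioWt m) w = 1 :=
    sum_prodWt (sum_scenarioWt m)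
  have hN' : (0 : ℝ) < N := by exact_mod_cast hN
  let E : (Fin d → ℝ) → (Fin K → ℝ) → ℝ := fun x γ => (trunc A (linComb ψ γ x) - q (Φ x v.1)) ^ 2
  let L : (Fin d → ℝ) → ℝ := fun x => (linComb ψ β x - q (Φ x v.1)) ^ 2
  -- The indicator of the scenario is put into the loss, so all `N` i.i.d. paths are used and no
  -- conditioning on the random number of paths in scenario `v` is needed. It also produces the
  -- factor `p_v`.
  let e : (Fin N → Fin J → Scenario m) → (Fin J → Scenario m) → ℝ := fun D w =>
    if w j = v then E (schemePath Φ x₀ (noiseOf w) j.castSucc) (α D) else 0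
  have hE0 : ∀ x γ, 0 ≤ E x γ := fun x γ => sq_nonneg _
  have hE : ∀ x γ, E x γ ≤ 4 * A ^ 2 := by
    intro x γ
    have h1 := abs_le.1 (abs_trunc_le hA (linComb ψ γ x))
    have h2 := abs_le.1 (hq x)
    have : |trunc A (linComb ψ γ x) - q (Φ x v.1)| ≤ 2 * A :=
      abs_le.2 ⟨by linarith, by linarith⟩
    calc E x γ = |trunc A (linComb ψ γ x) - q (Φ x v.1)| ^ 2 := (sq_abs _).symm
      _ ≤ (2 * A) ^ 2 := by gcongr
      _ = 4 * A ^ 2 := by ring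
  -- In scenario `v` the response is the regression function itself, without noise.
  have hrss : ∀ (D : Fin N → Fin J → Scenario m) (γ : Fin K → ℝ),
      rss Φ x₀ ψ q (fun i => noiseOf (D i)) j v.1 γ = ∑ i, if D i j = v then
        (linComb ψ γ (schemePath Φ x₀ (noiseOf (D i)) j.castSucc)
          - q (Φ (schemePath Φ x₀ (noiseOf (D i)) j.castSucc) v.1)) ^ 2 else 0 := by
    intro D γ
    rw [rss, Finset.sum_filter]
    refine Finset.sum_congr rfl fun i _ => ?_
    have : noiseOf (D i) j = v.1 ↔ D i j = v := Subtype.ext_iff.symm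
    simp only [this]
    split_ifs with h
    · rw [schemePath_succ, this.2 h]
    · rfl
  have hemp : ∀ D, ∑ i, e D (D i)
      ≤ ∑ i, if D i j = v then L (schemePath Φ x₀ (noiseOf (D i)) j.castSucc) else 0 := by
    intro D
    have h := hα D
    rw [hrss, hrss] at h
    refine le_trans (Finset.sum_le_sum fun i _ => ?_) h
    simp only [e]
    split_ifs
    · exact sq_le_sq.2 (abs_trunc_sub_le hA (hq _) _)
    · exact le_rfl
  -- The loss is at most `(2A)²`, and the double sample `Fin N × Bool` has `2N` points.
  have hmain := sum_prodWt_expectation_sub_le (N := N) (B := 4 * A ^ 2)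
    (S := (2 * N + 1) ^ K * (2 * N + 1) ^ K) hν hν1 e
    (by positivity) (fun D x => by simp only [e]; split_ifs <;> simp [hE0])
    (fun D x => by simp only [e]; split_ifs <;> [exact hE _ _; positivity])
    (fun t ht z => by
      obtain ⟨𝒯, h1, h2⟩ := exists_traces_trunc hA ht (fun a => z a j = v)
        (fun a k => ψ k (schemePath Φ x₀ (noiseOf (z a)) j.castSucc))
        (fun a => q (Φ (schemePath Φ x₀ (noiseOf (z a)) j.castSucc) v.1)) (fun _ => hq _) α
      refine ⟨𝒯, ?_, fun D => ?_⟩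
      · simpa [mul_comm N 2] using h1
      · convert h2 D
        rfl)
  have hx : ∀ D, ∑ w, prodWt (scenarioWt m) w * e D w
      = scenarioWt m v * ∑ w : Fin J → Scenario m, prodWt (scenarioWt m) w *
          E (schemePath Φ x₀ (noiseOf w) j.castSucc) (α D) := fun D =>
    sum_prodWt_ite j v fun x => E x (α D)
  have hexp : ∑ D : Fin N → Fin J → Scenario m, prodWt (prodWt (scenarioWt m)) D *
        ∑ i, (if D i j = v then L (schemePath Φ x₀ (noiseOf (D i)) j.castSucc) else 0)
      = N * (scenarioWt m v * ∑ w : Fin J → Scenario m, prodWt (scenarioWt m) w *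
          L (schemePath Φ x₀ (noiseOf w) j.castSucc)) := by
    rw [← sum_prodWt_ite j v L]
    simp only [Finset.mul_sum (s := (Finset.univ : Finset (Fin N)))]
    rw [Finset.sum_comm]
    have := fun i : Fin N => sum_prodWt_apply hν1 i fun w : Fin J → Scenario m =>
      if w j = v then L (schemePath Φ x₀ (noiseOf w) j.castSucc) else 0
    simp only [this, Finset.sum_const, Finset.card_univ, Fintype.card_fin, nsmul_eq_mul]
  have hle : ∑ D : Fin N → Fin J → Scenario m, prodWt (prodWt (scenarioWt m)) D *
        ∑ i, e D (D i) ≤ N * (scenarioWt m v * ∑ w : Fin J → Scenario m,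
          prodWt (scenarioWt m) w * L (schemePath Φ x₀ (noiseOf w) j.castSucc)) := by
    rw [← hexp]
    exact Finset.sum_le_sum fun D _ =>
      mul_le_mul_of_nonneg_left (hemp D) (prodWt_nonneg hν D)
  have hsplit : ∑ D : Fin N → Fin J → Scenario m, prodWt (prodWt (scenarioWt m)) D *
        (N * ∑ w, prodWt (scenarioWt m) w * e D w - 2 * ∑ i, e D (D i))
      = N * (∑ D : Fin N → Fin J → Scenario m, prodWt (prodWt (scenarioWt m)) D *
          ∑ w, prodWt (scenarioWt m) w * e D w)
        - 2 * ∑ D : Fin N → Fin J → Scenario m, prodWt (prodWt (scenarioWt m)) D *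
          ∑ i, e D (D i) := by
    rw [Finset.mul_sum, Finset.mul_sum, ← Finset.sum_sub_distrib]
    exact Finset.sum_congr rfl fun D _ => by ring
  rw [hsplit] at hmain
  simp only [hx] at hmain
  rw [← sub_le_iff_le_add', le_div_iff₀ hN']
  simp only [E, L] at hmain hle
  linarith

end Regression

/-! ### From the probability space to finite sums -/

section Transfer

variable {Ω : Type*} [MeasurableSpace Ω] {P : Measure Ω}

/-- A random variable with finitely many values `s x`, attained with the probabilities `p x`. -/
structure HasFiniteLaw {S E : Type*} [Fintype S] (Z : Ω → E) (s : S → E) (p : S → ℝ)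
    (P : Measure Ω) : Prop where
  injective : Function.Injective s
  measurableSet : ∀ x, MeasurableSet {ω | Z ω = s x}
  measure : ∀ x, P {ω | Z ω = s x} = ENNReal.ofReal (p x)
  pos : ∀ x, 0 < p x
  sum_eq_one : ∑ x, p x = 1

namespace HasFiniteLaw

variable {S E : Type*} [Fintype S] {Z : Ω → E} {s : S → E} {p : S → ℝ}

theorem ae_mem_range [IsProbabilityMeasure P] (h : HasFiniteLaw Z s p P) : ∀ᵐ ω ∂P, ∃ x, Z ω = s x := by
  have hU : {ω | ∃ x, Z ω = s x} = ⋃ x, {ω | Z ω = s x} := by ext; simp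
  have hm : MeasurableSet {ω | ∃ x, Z ω = s x} := by
    rw [hU]; exact MeasurableSet.iUnion h.measurableSet
  change {ω | ∃ x, Z ω = s x} ∈ ae P
  rw [mem_ae_iff_prob_eq_one hm, hU, measure_iUnion _ h.measurableSet, tsum_fintype]
  · simp only [h.measure]
    rw [← ENNReal.ofReal_sum_of_nonneg fun x _ => (h.pos x).le, h.sum_eq_one, ENNReal.ofReal_one]
  · intro x y hxy
    refine Set.disjoint_left.2 fun ω hx hy => hxy (h.injective ?_)
    have hx' : Z ω = s x := hx
    exact hx'.symm.trans hy

/-- An atom of positive probability cannot lie in a null set. -/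
theorem forall_of_ae (h : HasFiniteLaw Z s p P) {Q : E → Prop} (hQ : ∀ᵐ ω ∂P, Q (Z ω)) (x : S) :
    Q (s x) := by
  by_contra hx
  have h0 : P {ω | Z ω = s x} = 0 :=
    measure_mono_null (fun ω (hω : Z ω = s x) => by simpa [hω] using hx) hQ
  rw [h.measure, ENNReal.ofReal_eq_zero] at h0
  exact absurd (h.pos x) (not_lt.2 h0)

theorem ae_eq_sum [IsProbabilityMeasure P] (h : HasFiniteLaw Z s p P) (F : E → ℝ) :
    (fun ω => F (Z ω)) =ᵐ[P] fun ω => ∑ x, {ω | Z ω = s x}.indicator (fun _ => F (s x)) ω := by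
  filter_upwards [h.ae_mem_range] with ω ⟨x, hx⟩
  rw [Finset.sum_eq_single_of_mem x (Finset.mem_univ x)]
  · simp [hx]
  · intro y _ hy
    refine Set.indicator_of_notMem (fun hω => hy (h.injective ?_)) _
    have hω' : Z ω = s y := hω
    exact hω'.symm.trans hx

theorem memLp [IsProbabilityMeasure P] (h : HasFiniteLaw Z s p P) (F : E → ℝ) (r : ENNReal) :
    MemLp (fun ω => F (Z ω)) r P := by
  refine (memLp_congr_ae (h.ae_eq_sum F)).2 ?_
  exact memLp_finsetSum _ fun x _ => (memLp_const _).indicator (h.measurableSet x)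

theorem integral_eq [IsProbabilityMeasure P] (h : HasFiniteLaw Z s p P) (F : E → ℝ) :
    ∫ ω, F (Z ω) ∂P = ∑ x, p x * F (s x) := by
  rw [integral_congr_ae (h.ae_eq_sum F), integral_finsetSum]
  · refine Finset.sum_congr rfl fun x _ => ?_
    rw [integral_indicator_const _ (h.measurableSet x), measureReal_def, h.measure,
      ENNReal.toReal_ofReal (h.pos x).le, smul_eq_mul]
  · exact fun x _ => (integrable_const _).indicator (h.measurableSet x)

end HasFiniteLaw

variable {m J N : ℕ}

theorem IsInnovation.measure_eq {ι : Type*} {ζ : ι → Ω → Noise m} (h : IsInnovation ζ P) (a : ι)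
    (v : Scenario m) : P {ω | ζ a ω = v.1} = ENNReal.ofReal (scenarioWt m v) := by
  obtain ⟨hv1, hv2⟩ := mem_grid.1 v.2
  have hset : {ω | ζ a ω = v.1}
      = (fun ω => (ζ a ω).1) ⁻¹' {v.1.1} ∩ (fun ω => (ζ a ω).2) ⁻¹' {v.1.2} := by
    ext ω; simp [Prod.ext_iff]
  have h1 : (fun ω => (ζ a ω).1) ⁻¹' {v.1.1}
      = ⋂ k ∈ (Finset.univ : Finset (Fin m)), (fun ω => (ζ a ω).1 k) ⁻¹' {v.1.1 k} := by
    ext ω; simp [funext_iff]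
  have h2 : (fun ω => (ζ a ω).2) ⁻¹' {v.1.2}
      = ⋂ k ∈ (Finset.univ : Finset (Pairs m)), (fun ω => (ζ a ω).2 k) ⁻¹' {v.1.2 k} := by
    ext ω; simp only [Set.mem_preimage, Set.mem_singleton_iff, funext_iff, Finset.mem_univ,
      Set.iInter_true, Set.mem_iInter]
  have e1 : ∀ k, P ((fun ω => (ζ a ω).1 k) ⁻¹' {v.1.1 k})
      = ENNReal.ofReal (if v.1.1 k = 0 then 2 / 3 else 1 / 6) := by
    intro k
    have h6 : ENNReal.ofReal (1 / 6) = 1 / 6 := by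
      rw [ENNReal.ofReal_div_of_pos (by norm_num)]; simp
    have h23 : ENNReal.ofReal (2 / 3) = 2 / 3 := by
      rw [ENNReal.ofReal_div_of_pos (by norm_num)]; simp
    rcases hv1 k with hk | hk | hk <;> rw [hk]
    · rw [if_neg (neg_ne_zero.2 sqrt_three_ne_zero), h6]
      exact h.fst_neg a k
    · rw [if_pos rfl, h23]
      exact h.fst_zero a k
    · rw [if_neg sqrt_three_ne_zero, h6]
      exact h.fst_pos a k
  have e2 : ∀ k, P ((fun ω => (ζ a ω).2 k) ⁻¹' {v.1.2 k}) = ENNReal.ofReal (1 / 2) := by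
    intro k
    have h12 : ENNReal.ofReal (1 / 2) = 1 / 2 := by
      rw [ENNReal.ofReal_div_of_pos (by norm_num)]; simp
    rw [h12]
    rcases hv2 k with hk | hk <;> rw [hk]
    · exact h.snd_neg a k
    · exact h.snd_pos a k
  rw [hset, (h.indep_fst_snd a).measure_inter_preimage_eq_mul _ _ (measurableSet_singleton _)
    (measurableSet_singleton _), h1, h2,
    (h.indep_fst a).measure_inter_preimage_eq_mul _ (fun _ _ => measurableSet_singleton _),
    (h.indep_snd a).measure_inter_preimage_eq_mul _ (fun _ _ => measurableSet_singleton _)]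
  simp only [e1, e2]
  rw [scenarioWt, prob_eq_prod, ENNReal.ofReal_mul, ENNReal.ofReal_prod_of_nonneg,
    ENNReal.ofReal_prod_of_nonneg]
  · intros; norm_num
  · intros; split_ifs <;> norm_num
  · exact Finset.prod_nonneg fun _ _ => by split_ifs <;> norm_num

theorem IsInnovation.measure_pi_eq {ι : Type*} [Fintype ι] {ζ : ι → Ω → Noise m}
    (h : IsInnovation ζ P) (w : ι → Scenario m) :
    P {ω | (fun a => ζ a ω) = fun a => (w a).1}
      = ENNReal.ofReal (prodWt (scenarioWt m) w) := by
  have hset : {ω | (fun a => ζ a ω) = fun a => (w a).1}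
      = ⋂ a ∈ (Finset.univ : Finset ι), ζ a ⁻¹' {(w a).1} := by
    ext ω; simp [funext_iff]
  rw [hset, h.indep.measure_inter_preimage_eq_mul _ (fun _ _ => measurableSet_singleton _),
    prodWt, ENNReal.ofReal_prod_of_nonneg fun _ _ => (scenarioWt_pos _).le]
  exact Finset.prod_congr rfl fun a _ => h.measure_eq a (w a)

theorem measurableSet_eq_pi {ι : Type*} [Fintype ι] {ζ : ι → Ω → Noise m}
    (h : ∀ a, Measurable (ζ a)) (w : ι → Noise m) : MeasurableSet {ω | (fun a => ζ a ω) = w} :=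
  measurable_pi_lambda _ h (measurableSet_singleton w)

theorem IsInnovation.hasFiniteLaw {ζ : Fin J → Ω → Noise m} (h : IsInnovation ζ P) :
    HasFiniteLaw (fun ω j => ζ j ω) (noiseOf (m := m) (J := J)) (prodWt (scenarioWt m)) P where
  injective _ _ hw := funext fun j => Subtype.ext (congrFun hw j)
  measurableSet _ := measurableSet_eq_pi h.measurable _
  measure w := h.measure_pi_eq w
  pos := prodWt_pos scenarioWt_pos
  sum_eq_one := sum_prodWt (sum_scenarioWt m)

theorem hasFiniteLaw_prod {ζ : Fin J → Ω → Noise m} {ζtr : Fin N × Fin J → Ω → Noise m}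
    (h : IsInnovation ζ P) (htr : IsInnovation ζtr P)
    (hind : IndepFun (fun ω j => ζ j ω) (fun ω a => ζtr a ω) P) :
    HasFiniteLaw (fun ω => ((fun j => ζ j ω, fun i j => ζtr (i, j) ω) :
        (Fin J → Noise m) × Training m J N))
      (fun a : (Fin J → Scenario m) × (Fin N → Fin J → Scenario m) =>
        (noiseOf a.1, fun i => noiseOf (a.2 i)))
      (fun a => prodWt (scenarioWt m) a.1 * prodWt (prodWt (scenarioWt m)) a.2) P := by
  have hset : ∀ a : (Fin J → Scenario m) × (Fin N → Fin J → Scenario m),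
      {ω | ((fun j => ζ j ω, fun i j => ζtr (i, j) ω) : (Fin J → Noise m) × Training m J N)
        = (noiseOf a.1, fun i => noiseOf (a.2 i))}
      = (fun ω j => ζ j ω) ⁻¹' {noiseOf a.1}
        ∩ (fun ω b => ζtr b ω) ⁻¹' {fun b => (a.2 b.1 b.2).1} := by
    intro a
    ext ω
    simp [Prod.ext_iff, funext_iff, noiseOf]
  refine ⟨?_, ?_, ?_, ?_, ?_⟩
  · rintro ⟨w, D⟩ ⟨w', D'⟩ hw
    have h1 := congrArg Prod.fst hw
    have h2 := congrArg Prod.snd hw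
    exact Prod.ext (funext fun j => Subtype.ext (congrFun h1 j))
      (funext fun i => funext fun j => Subtype.ext (congrFun (congrFun h2 i) j))
  · intro a
    rw [hset]
    exact (measurableSet_eq_pi h.measurable _).inter (measurableSet_eq_pi htr.measurable _)
  · intro a
    rw [hset, hind.measure_inter_preimage_eq_mul _ _ (measurableSet_singleton _)
      (measurableSet_singleton _),
      ENNReal.ofReal_mul (prodWt_nonneg (fun v => (scenarioWt_pos v).le) _)]
    congr 1
    · exact h.measure_pi_eq a.1
    · refine (htr.measure_pi_eq fun b => a.2 b.1 b.2).trans ?_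
      rw [prodWt, Fintype.prod_prod_type]
      rfl
  · exact fun a => mul_pos (prodWt_pos scenarioWt_pos _)
      (prodWt_pos (prodWt_pos scenarioWt_pos) _)
  · rw [Fintype.sum_prod_type]
    have h1 : ∑ w : Fin J → Scenario m, prodWt (scenarioWt m) w = 1 :=
      sum_prodWt (sum_scenarioWt m)
    simp only [← Finset.mul_sum, sum_prodWt h1, mul_one, h1]

end Transfer
-- Conditional expectations and state laws as finite sums
section Identification

variable {Ω : Type*} [MeasurableSpace Ω] {P : Measure Ω} [IsProbabilityMeasure P] {d m J : ℕ}
  {Φ : (Fin d → ℝ) → Noise m → (Fin d → ℝ)}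

theorem measurable_pathFrom (hΦ : Measurable (Function.uncurry Φ)) (w : Fin J → Noise m)
    (s k : Fin (J + 1)) : Measurable fun x => pathFrom Φ w s x k := by
  induction k using Fin.induction with
  | zero => exact measurable_id
  | succ j ih =>
    simp only [pathFrom_succ]
    split_ifs
    · exact hΦ.comp (ih.prodMk measurable_const)
    · exact measurable_id

theorem measurable_schemePath (hΦ : Measurable (Function.uncurry Φ)) (x₀ : Fin d → ℝ)
    {ζ : Fin J → Ω → Noise m} (hζ : ∀ j, Measurable (ζ j)) (k : Fin (J + 1)) :
    Measurable fun ω => schemePath Φ x₀ (fun j => ζ j ω) k := by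
  induction k using Fin.induction with
  | zero => exact measurable_const
  | succ j ih =>
    simp only [schemePath_succ]
    exact hΦ.comp (ih.prodMk (hζ j))

theorem measurable_scenarioMean (hΦ : Measurable (Function.uncurry Φ)) {f : (Fin d → ℝ) → ℝ}
    (hf : Measurable f) (j : Fin (J + 1)) :
    Measurable fun x => scenarioMean (J := J) Φ f j x := by
  unfold scenarioMean
  exact Finset.measurable_sum _ fun w _ =>
    (hf.comp (measurable_pathFrom hΦ _ _ _)).const_mul _

theorem measurable_linComb {K : ℕ} {ψ : Fin K → (Fin d → ℝ) → ℝ} (hψ : ∀ k, Measurable (ψ k))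
    (β : Fin K → ℝ) : Measurable (linComb ψ β) := by
  unfold linComb
  exact Finset.measurable_sum _ fun k _ => (hψ k).const_mul _

theorem qFun_eq_scenarioMean {ζ : Fin J → Ω → Noise m} (h : IsInnovation ζ P)
    (f : (Fin d → ℝ) → ℝ) : qFun P ζ Φ f = scenarioMean Φ f := by
  funext j x
  exact h.hasFiniteLaw.integral_eq fun w => f (pathFrom Φ w j x (Fin.last J))

theorem integral_stateLaw (hΦ : Measurable (Function.uncurry Φ)) (x₀ : Fin d → ℝ)
    {ζ : Fin J → Ω → Noise m} (h : IsInnovation ζ P) (j : Fin J) {F : (Fin d → ℝ) → ℝ}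
    (hF : Measurable F) :
    ∫ x, F x ∂(stateLaw P ζ Φ x₀ j) = ∑ w : Fin J → Scenario m, prodWt (scenarioWt m) w *
      F (schemePath Φ x₀ (noiseOf w) j.castSucc) := by
  rw [stateLaw, integral_map (measurable_schemePath hΦ x₀ h.measurable _).aemeasurable
    hF.aestronglyMeasurable]
  exact h.hasFiniteLaw.integral_eq fun w => F (schemePath Φ x₀ w j.castSucc)

theorem linComb_mem_span {K : ℕ} (ψ : Fin K → (Fin d → ℝ) → ℝ) (g : (Fin d → ℝ) → ℝ)
    (hg : g ∈ Submodule.span ℝ (Set.range ψ)) : ∃ β, linComb ψ β = g := by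
  obtain ⟨β, hβ⟩ := (Submodule.mem_span_range_iff_exists_fun ℝ).1 hg
  refine ⟨β, ?_⟩
  rw [← hβ]
  funext x
  simp [linComb]

end Identification

/-! ### Numerical constants -/

section Constants

theorem log_traces_le {N : ℕ} (hN : 1 ≤ N) (K : ℕ) :
    Real.log (((2 * N + 1) ^ K * (2 * N + 1) ^ K : ℕ) : ℝ) ≤ 4 * K * (Real.log N + 1) := by
  have hN' : (1 : ℝ) ≤ N := by exact_mod_cast hN
  have h3 : Real.log 3 ≤ 2 := by
    have := Real.log_le_sub_one_of_pos (x := 3) (by norm_num)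
    linarith
  have h0 : 0 ≤ Real.log N := Real.log_nonneg hN'
  have h1 : Real.log (2 * N + 1) ≤ 2 * (Real.log N + 1) := by
    calc Real.log (2 * N + 1) ≤ Real.log (3 * N) :=
          Real.log_le_log (by positivity) (by linarith)
      _ = Real.log 3 + Real.log N := Real.log_mul (by norm_num) (by positivity)
      _ ≤ 2 * (Real.log N + 1) := by linarith
  have hK : (0 : ℝ) ≤ K := Nat.cast_nonneg K
  push_cast
  rw [Real.log_mul (by positivity) (by positivity), Real.log_pow]
  nlinarith

/-- From `c_m ≥ 3^m = 2^m (3/2)^m ≥ 2 (3/2)^m`. -/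
theorem one_le_scenarioCount_sub {m : ℕ} (hm : m ≠ 0) :
    (2 : ℝ) ≤ scenarioCount m ∧ 1 ≤ (scenarioCount m : ℝ) - (3 / 2 : ℝ) ^ m := by
  have h1 : (1 : ℝ) ≤ (3 / 2 : ℝ) ^ m := one_le_pow₀ (by norm_num)
  have h2 : (2 : ℝ) ≤ 2 ^ m := le_self_pow₀ (by norm_num) hm
  have h3 : (3 : ℝ) ^ m = 2 ^ m * (3 / 2) ^ m := by rw [← mul_pow]; norm_num
  have h4 : (3 : ℝ) ^ m ≤ scenarioCount m := by
    rw [scenarioCount]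
    push_cast
    exact le_mul_of_one_le_right (by positivity) (one_le_pow₀ (by norm_num))
  constructor <;> nlinarith

end Constants

end SRCV

/-! ### The variance bound -/

theorem theorem3 :
    ∃ c : ℝ, 0 < c ∧
      ∀ (d m J N K : ℕ), 1 ≤ N → 1 ≤ K →
      ∀ (Ω : Type*) [MeasurableSpace Ω] (P : Measure Ω) [IsProbabilityMeasure P]
        -- the scheme, the functional and the basis functions
        (Φ : (Fin d → ℝ) → Noise m → (Fin d → ℝ)) (x₀ : Fin d → ℝ)
        (f : (Fin d → ℝ) → ℝ) (ψ : Fin K → (Fin d → ℝ) → ℝ),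
      Measurable (Function.uncurry Φ) → Measurable f → (∀ k, Measurable (ψ k)) →
      -- innovations of the testing path and, independent of them, of the `N` training paths
      ∀ (ζ : Fin J → Ω → Noise m) (ζtr : Fin N × Fin J → Ω → Noise m),
      IsInnovation ζ P → IsInnovation ζtr P →
      IndepFun (fun ω j => ζ j ω) (fun ω a => ζtr a ω) P →
      ∀ (A κ Cκ : ℝ), 0 < A → 0 < κ → 0 < Cκ →
      -- (A1)
      (∀ j, ∀ w ∈ grid m, ∀ x, |hFun P ζ Φ f j w x| ≤ A) →
      -- (A2)
      (∀ j, ∀ w ∈ grid m,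
        (⨅ g : Submodule.span ℝ (Set.range ψ),
          ∫ x, (hFun P ζ Φ f j w x - (g : (Fin d → ℝ) → ℝ) x) ^ 2 ∂(stateLaw P ζ Φ x₀ j))
            ≤ Cκ / (K : ℝ) ^ κ) →
      -- (A3) least squares coefficients, computed from the training data
      ∀ (α : Training m J N → Fin J → Noise m → Fin K → ℝ),
      (∀ j w, Measurable fun D => α D j w) →
      (∀ᵐ ω ∂P, ∀ j, ∀ w ∈ grid m, ∀ β : Fin K → ℝ,
        rss Φ x₀ ψ (qFun P ζ Φ f j.succ) (fun i j => ζtr (i, j) ω) j w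
            (α (fun i j => ζtr (i, j) ω) j w)
          ≤ rss Φ x₀ ψ (qFun P ζ Φ f j.succ) (fun i j => ζtr (i, j) ω) j w β) →
      MemLp (fun ω => f (schemePath Φ x₀ (fun j => ζ j ω) (Fin.last J))
          - controlVariate Φ x₀ ψ A (α fun i j => ζtr (i, j) ω) (fun j => ζ j ω)) 2 P ∧
      Var[fun ω => f (schemePath Φ x₀ (fun j => ζ j ω) (Fin.last J))
          - controlVariate Φ x₀ ψ A (α fun i j => ζtr (i, j) ω) (fun j => ζ j ω); P]
        ≤ J * (((scenarioCount m : ℝ) - 1) * scenarioCount m * c * A ^ 2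
              * (Real.log N + 1) * (K / N)
            + 8 * Cκ / (K : ℝ) ^ κ * (scenarioCount m - (3 / 2 : ℝ) ^ m)) := by
  have hlam : 0 < Real.log (3 / 2 : ℝ) := Real.log_pos (by norm_num)
  -- Product of the loss bound `4 A²` and the 4 of `log_traces_le`, over the exponent `log (3/2)`.
  refine ⟨16 / Real.log (3 / 2), by positivity, ?_⟩
  intro d m J N K hN hK Ω _ P _ Φ x₀ f ψ hΦ hf hψ ζ ζtr hζ hζtr hind A κ Cκ hA hκ hCκ hA1 hA2 α hα
    hmin
  have hlaw := hasFiniteLaw_prod hζ hζtr hind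
  have hq := qFun_eq_scenarioMean (Φ := Φ) hζ f
  let F : (Fin J → Noise m) × Training m J N → ℝ := fun a =>
    f (schemePath Φ x₀ a.1 (Fin.last J)) - controlVariate Φ x₀ ψ A (α a.2) a.1
  let c : ℝ := scenarioMean (J := J) Φ f 0 x₀
  have hmem := hlaw.memLp F 2
  refine ⟨hmem, ?_⟩
  have hvar : Var[fun ω => F (fun j => ζ j ω, fun i j => ζtr (i, j) ω); P]
      ≤ ∑ D : Fin N → Fin J → Scenario m, prodWt (prodWt (scenarioWt m)) D *
        ∑ w : Fin J → Scenario m, prodWt (scenarioWt m) w *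
          (F (noiseOf w, fun i => noiseOf (D i)) - c) ^ 2 := by
    -- Any constant may replace the mean in an upper bound of the variance; `c` is the mean of
    -- `f(X_J)`.
    rw [← variance_sub_const hmem.aestronglyMeasurable c]
    refine (variance_le_expectation_sq
      (hlaw.memLp (fun a => F a - c) 2).aestronglyMeasurable).trans (le_of_eq ?_)
    refine (hlaw.integral_eq fun a => (F a - c) ^ 2).trans ?_
    rw [Fintype.sum_prod_type, Finset.sum_comm]
    refine Finset.sum_congr rfl fun D _ => ?_
    rw [Finset.mul_sum]
    exact Finset.sum_congr rfl fun w _ => by ring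
  refine hvar.trans ?_
  let g : (Fin N → Fin J → Scenario m) → Fin J → Scenario m → (Fin d → ℝ) → ℝ := fun D j v x =>
    trunc A (linComb ψ (α (fun i => noiseOf (D i)) j v.1) x)
  have hF : ∀ (w : Fin J → Scenario m) (D : Fin N → Fin J → Scenario m),
      F (noiseOf w, fun i => noiseOf (D i)) = f (schemePath Φ x₀ (noiseOf w) (Fin.last J))
        - ∑ j, (g D j (w j) (schemePath Φ x₀ (noiseOf w) j.castSucc)
          - ∑ v, scenarioWt m v * g D j v (schemePath Φ x₀ (noiseOf w) j.castSucc)) := by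
    intro w D
    simp only [F, controlVariate]
    congr 1
    exact Finset.sum_congr rfl fun j _ => sum_aTilde_mul_chaos ψ A _ _ (w j)
  simp only [hF, c]
  rcases eq_or_ne m 0 with rfl | hm
  · have : Subsingleton (Scenario 0) := by
      rw [← Fintype.card_le_one_iff_subsingleton, card_scenario]
      simp [scenarioCount]
    refine (Finset.sum_eq_zero fun D _ => ?_).trans_le ?_
    · rw [sum_prodWt_terminal_sub_sq_eq_zero, mul_zero]
    · simp [scenarioCount]
  have hmin' : ∀ (D : Fin N → Fin J → Scenario m) (j : Fin J), ∀ w ∈ grid m, ∀ β : Fin K → ℝ,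
      rss Φ x₀ ψ (scenarioMean Φ f j.succ) (fun i => noiseOf (D i)) j w
          (α (fun i => noiseOf (D i)) j w)
        ≤ rss Φ x₀ ψ (scenarioMean Φ f j.succ) (fun i => noiseOf (D i)) j w β := by
    intro D
    rw [hq] at hmin
    obtain ⟨w⟩ : Nonempty (Fin J → Scenario m) := by
      have : Nonempty (Scenario m) := by
        rw [← Fintype.card_pos_iff, card_scenario, scenarioCount]
        positivity
      infer_instance
    exact hlaw.forall_of_ae (Q := fun a => ∀ (j : Fin J), ∀ w ∈ grid m, ∀ β : Fin K → ℝ,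
      rss Φ x₀ ψ (scenarioMean Φ f j.succ) a.2 j w (α a.2 j w)
        ≤ rss Φ x₀ ψ (scenarioMean Φ f j.succ) a.2 j w β) hmin (w, D)
  simp only [hFun, hq] at hA1 hA2
  set B : ℝ := 4 * A ^ 2 * (Real.log (((2 * N + 1) ^ K * (2 * N + 1) ^ K : ℕ) : ℝ)
    / Real.log (3 / 2)) / N with hB
  set R : ℝ := Cκ / (K : ℝ) ^ κ with hR
  have hN' : (0 : ℝ) < N := by exact_mod_cast hN
  have hK' : (0 : ℝ) < K := by exact_mod_cast hK
  have hreg : ∀ (j : Fin J) (v : Scenario m),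
      ∑ D : Fin N → Fin J → Scenario m, prodWt (prodWt (scenarioWt m)) D *
        (scenarioWt m v * ∑ w : Fin J → Scenario m, prodWt (scenarioWt m) w *
          approxError Φ f (g D) j v (schemePath Φ x₀ (noiseOf w) j.castSucc) ^ 2)
        ≤ 2 * (scenarioWt m v * R) + B := by
    intro j v
    have hv := scenarioWt_pos v
    set E := ∑ D : Fin N → Fin J → Scenario m, prodWt (prodWt (scenarioWt m)) D *
        (scenarioWt m v * ∑ w : Fin J → Scenario m, prodWt (scenarioWt m) w *
          approxError Φ f (g D) j v (schemePath Φ x₀ (noiseOf w) j.castSucc) ^ 2) with hE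
    -- The estimate for each `g` in the span is solved for its approximation error. The left side is
    -- then a lower bound of the infimum in (A2), which need not be attained.
    have hinf : (E - B) / (2 * scenarioWt m v) ≤ R := by
      refine le_trans (le_ciInf fun G => ?_) (hA2 j v.1 v.2)
      obtain ⟨β, hβ⟩ := linComb_mem_span ψ _ G.2
      have hmeas : Measurable fun x => (scenarioMean Φ f j.succ (Φ x v.1)
          - (G : (Fin d → ℝ) → ℝ) x) ^ 2 := by
        rw [← hβ]
        exact (((measurable_scenarioMean hΦ hf _).comp
          (hΦ.comp (measurable_id.prodMk measurable_const))).sub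
            (measurable_linComb hψ β)).pow_const 2
      rw [integral_stateLaw hΦ x₀ hζ j hmeas, ← hβ, div_le_iff₀ (by positivity)]
      have := scenarioWt_mul_regression_error_le (Φ := Φ) (x₀ := x₀) hN ψ
        (scenarioMean Φ f j.succ) j v hA (hA1 j v.1 v.2)
        (fun D => α (fun i => noiseOf (D i)) j v.1) β fun D => hmin' D j v.1 v.2 β
      simp only [hE, approxError, g, sub_sq_comm (scenarioMean Φ f j.succ _)]
      linarith
    rw [div_le_iff₀ (by positivity)] at hinf
    linarith
  have hwt : ∀ D : Fin N → Fin J → Scenario m, 0 ≤ prodWt (prodWt (scenarioWt m)) D :=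
    prodWt_nonneg fun w => prodWt_nonneg (fun v => (scenarioWt_pos v).le) w
  obtain ⟨hc2, hc1⟩ := one_le_scenarioCount_sub hm
  have hR0 : 0 ≤ R := by positivity
  have hlogN : 0 ≤ Real.log N := Real.log_nonneg (by exact_mod_cast hN)
  have hBle : B ≤ 16 / Real.log (3 / 2) * A ^ 2 * (Real.log N + 1) * (K / N) := by
    have h := log_traces_le hN K
    calc B ≤ 4 * A ^ 2 * (4 * K * (Real.log N + 1) / Real.log (3 / 2)) / N := by
          rw [hB]; gcongr
      _ = _ := by ring
  calc _ ≤ ∑ D : Fin N → Fin J → Scenario m, prodWt (prodWt (scenarioWt m)) D *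
        ∑ j, ∑ v, scenarioWt m v * ∑ w : Fin J → Scenario m, prodWt (scenarioWt m) w *
          approxError Φ f (g D) j v (schemePath Φ x₀ (noiseOf w) j.castSucc) ^ 2 :=
        Finset.sum_le_sum fun D _ => mul_le_mul_of_nonneg_left
          (sum_prodWt_terminal_sub_sq_le Φ f x₀ (g D)) (hwt D)
    _ = ∑ j, ∑ v, ∑ D : Fin N → Fin J → Scenario m, prodWt (prodWt (scenarioWt m)) D *
          (scenarioWt m v * ∑ w : Fin J → Scenario m, prodWt (scenarioWt m) w *
          approxError Φ f (g D) j v (schemePath Φ x₀ (noiseOf w) j.castSucc) ^ 2) := by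
        simp only [Finset.mul_sum (s := (Finset.univ : Finset (Fin J))),
          Finset.mul_sum (s := (Finset.univ : Finset (Scenario m)))]
        rw [Finset.sum_comm]
        exact Finset.sum_congr rfl fun j _ => Finset.sum_comm
    _ ≤ ∑ _j : Fin J, ∑ v, (2 * (scenarioWt m v * R) + B) :=
        Finset.sum_le_sum fun j _ => Finset.sum_le_sum fun v _ => hreg j v
    _ = J * (2 * R + scenarioCount m * B) := by
        simp only [Finset.sum_add_distrib, ← Finset.mul_sum, ← Finset.sum_mul, sum_scenarioWt,
          Finset.sum_const, Finset.card_univ, card_scenario, Fintype.card_fin, nsmul_eq_mul]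
        ring
    _ ≤ _ := by
        refine mul_le_mul_of_nonneg_left ?_ (Nat.cast_nonneg J)
        rw [mul_div_assoc, ← hR]
        have h1 : scenarioCount m * B ≤ ((scenarioCount m : ℝ) - 1) * scenarioCount m
            * (16 / Real.log (3 / 2)) * A ^ 2 * (Real.log N + 1) * (K / N) := by
          calc scenarioCount m * B ≤ scenarioCount m *
                (16 / Real.log (3 / 2) * A ^ 2 * (Real.log N + 1) * (K / N)) := by gcongr
            _ ≤ ((scenarioCount m : ℝ) - 1) * (scenarioCount m *
                (16 / Real.log (3 / 2) * A ^ 2 * (Real.log N + 1) * (K / N))) :=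
              le_mul_of_one_le_left (by positivity) (by linarith)
            _ = _ := by ring
        -- Here `2 R ≤ 8 R (c_m - (3/2)^m)`, since the last factor is at least 1.
        nlinarith
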